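/- Let $\mathbb{F}\in\{\mathbb{R},\mathbb{C}\}$ and let $M$ be a Hausdorff smooth manifold (of dimension $n$, locally modelled on $\mathbb{R}^n$, without boundary). Let $R=C_c^\infty(M)$ be the commutative ring, in general without identity, of smooth $\mathbb{F}$-valued functions with compact support on $M$. **Sheaves.** $\mathrm{Sh}(M)$ is the category whose objects are local diffeomorphisms $\pi:E\to M$ from a not necessarily Hausdorff manifold $E$, and whose morphisms are smooth maps over $M$. **Coalgebras.** An $R$-module $C$ is locally unitary if for any $c_1,\dots,c_k\in C$ there is $r\in R$ with $rc_i=c_i$ for all $i$. A coalgebra over $R$ is a locally unitary $R$-module $C$ with $R$-linear maps $\Delta:C\to C\otimes_R C$ and $\epsilon:C\to R$ such that $(\mathrm{id}\otimes\epsilon)\circ\Delta=\mathrm{id}=(\epsilon\otimes\mathrm{id})\circ\Delta$ (under $C\otimes_R R\cong C\cong R\otimes_R C$). Homomorphisms of coalgebras are the $R$-linear maps that commute with $\Delta$ and $\epsilon$. The resulting category is $\mathrm{CoAlg}(R)$. **The functor $C_c^\infty$.** For a not necessarily Hausdorff manifold $E$, the space $C_c^\infty(E)$ consists of the finite sums,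 in the space of all (not necessarily continuous) sections $y\mapsto u_y$ of the sheaf of germs of smooth $\mathbb{F}$-valued functions on $E$, of extensions by zero of smooth functions with compact support on Hausdorff open subsets of $E$; for Hausdorff $E$ these are the usual smooth functions with compact support. A local diffeomorphism $\phi:E\to F$ induces $\phi_+:C_c^\infty(E)\to C_c^\infty(F)$, $\phi_+(u)_z=\sum_{y\in\phi^{-1}(z)}\phi_{*y}(u_y)$, where $\phi_{*y}$ is the inverse of the isomorphism of germs given by composition with $\phi$. For a sheaf $\pi:E\to M$, $R$ acts on $C_c^\infty(E)$ by $(fu)_y=(f\circ\pi)_y\,u_y$. For two sheaves $E,F$ on $M$ there is a natural isomorphism $\Omega:C_c^\infty(E)\otimes_R C_c^\infty(F)\to C_c^\infty(E\times_M F)$, $\Omega(u\otimes v)_{(y,z)}=\mathrm{pr}_1^*(u_y)\,\mathrm{pr}_2^*(v_z)$, and $C_c^\infty(E)$ is a coalgebra over $R$ with $\Delta=\Omega^{-1}\circ\mathrm{diag}_+$ and $\epsilon=\pi_+$, where $\mathrm{diag}:E\to E\times_M E$ is the diagonal. With $\phi\mapsto\phi_+$ on morphisms this defines a functor $C_c^\infty:\mathrm{Sh}(M)\to\mathrm{CoAlg}(C_c^\infty(M))$.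 **The functor $\mathcal{E}_{sp}$.** For a coalgebra $C$ over $R$ and $x\in M$ put $N_x(C)=\{c\in C : fc=0 \text{ for some } f\in R \text{ equal to } 1 \text{ near } x\}$, $C_x=C/N_x(C)$, and write $c_x$ for the class of $c\in C$. Then $C_x$ is a coalgebra over the ring $R_x$ of germs at $x$ of smooth functions, with the induced $\Delta_x$ and $\epsilon_x$; let $G(C_x)=\{\zeta\in C_x:\Delta_x(\zeta)=\zeta\otimes\zeta,\ \epsilon_x(\zeta)=1\}$ be its set of grouplike elements. The spectral sheaf $\mathcal{E}_{sp}(C)$ is the disjoint union of the sets $G(C_x)$, $x\in M$, with the obvious projection to $M$ (so its stalk at $x$ is $G(C_x)$), with the topology that has as basis the sets $c_W=\{c_x : x\in W\}$, where $W\subset M$ is open and $c\in C$ satisfies $\Delta(c)=c\otimes c'$ for some $c'\in C$ and $\epsilon(c)_x=1$ as a germ for every $x\in W$, and with the smooth structure for which the projection is a local diffeomorphism. A homomorphism $\alpha:C\to D$ induces maps $\alpha_x:C_x\to D_x$, which restrict to $G(C_x)\to G(D_x)$ and define $\mathcal{E}_{sp}(\alpha):\mathcal{E}_{sp}(C)\to\mathcal{E}_{sp}(D)$.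 This gives a functor $\mathcal{E}_{sp}:\mathrm{CoAlg}(C_c^\infty(M))\to\mathrm{Sh}(M)$. **Theorem.** The functor $C_c^\infty:\mathrm{Sh}(M)\to\mathrm{CoAlg}(C_c^\infty(M))$ is left adjoint to $\mathcal{E}_{sp}:\mathrm{CoAlg}(C_c^\infty(M))\to\mathrm{Sh}(M)$, and it is fully faithful. -/

import Mathlib

set_option linter.unusedSectionVars false

open scoped Manifold ContDiff Topology
open Filter CategoryTheory

universe u v

namespace SheafCoalg

noncomputable section Algebra

/-- A (left) module `C` over a commutative ring `R` that need not have an identity. -/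
class NUModule (R : Type*) [NonUnitalCommRing R] (C : Type*) [AddCommGroup C] extends
    SMul R C where
  smul_add' : ∀ (r : R) (c d : C), r • (c + d) = r • c + r • d
  add_smul' : ∀ (r s : R) (c : C), (r + s) • c = r • c + s • c
  mul_smul' : ∀ (r s : R) (c : C), (r * s) • c = r • s • c

variable {R : Type*} [NonUnitalCommRing R]
variable {C C' C'' D D' D'' A : Type*} [AddCommGroup C] [AddCommGroup C'] [AddCommGroup C'']
  [AddCommGroup D] [AddCommGroup D'] [AddCommGroup D''] [AddCommGroup A]
  [NUModule R C] [NUModule R C'] [NUModule R C''] [NUModule R D] [NUModule R D'] [NUModule R D'']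
  [NUModule R A]

/-- The commutative ring `R` as a module over itself. -/
instance NUModule.self : NUModule R R where
  smul_add' := mul_add
  add_smul' := add_mul
  mul_smul' := mul_assoc

/-- Multiplication by `r` as an additive endomorphism. -/
def smulHom (r : R) : C →+ C where
  toFun c := r • c
  map_zero' := by
    have := NUModule.smul_add' r (0 : C) 0
    simpa using this
  map_add' := NUModule.smul_add' r

@[simp] theorem smulHom_apply (r : R) (c : C) : smulHom r c = r • c := rfl

theorem nu_smul_zero (r : R) : r • (0 : C) = 0 := (smulHom r).map_zero
theorem nu_smul_add (r : R) (c d : C) : r • (c + d) = r • c + r • d := (smulHom r).map_add c d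
theorem nu_smul_neg (r : R) (c : C) : r • (-c) = -(r • c) := (smulHom r).map_neg c
theorem nu_smul_sub (r : R) (c d : C) : r • (c - d) = r • c - r • d := (smulHom r).map_sub c d

/-- The additive map `r ↦ r • c`. -/
def smulFlip (c : C) : R →+ C where
  toFun r := r • c
  map_zero' := by
    have := NUModule.add_smul' (0 : R) 0 c
    simpa using this
  map_add' r s := NUModule.add_smul' r s c

theorem nu_zero_smul (c : C) : (0 : R) • c = 0 := (smulFlip c).map_zero
theorem nu_add_smul (r s : R) (c : C) : (r + s) • c = r • c + s • c := (smulFlip c).map_add r s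
theorem nu_sub_smul (r s : R) (c : C) : (r - s) • c = r • c - s • c := (smulFlip c).map_sub r s
theorem nu_mul_smul (r s : R) (c : C) : (r * s) • c = r • s • c := NUModule.mul_smul' r s c
theorem nu_smul_comm (r s : R) (c : C) : r • s • c = s • r • c := by
  rw [← nu_mul_smul, mul_comm, nu_mul_smul]
theorem nu_self_smul (r s : R) : r • s = r * s := rfl

variable (R) in
/-- Locally unitary modules: finitely many elements have a common identity in `R`. -/
def IsLocallyUnitary (C : Type*) [AddCommGroup C] [NUModule R C] : Prop :=
  ∀ s : Finset C, ∃ r : R, ∀ c ∈ s, r • c = c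

/-- It is enough to have an identity for each single element. -/
theorem isLocallyUnitary_of_forall (h : ∀ c : C, ∃ r : R, r • c = c) :
    IsLocallyUnitary R C := by
  classical
  intro s
  induction s using Finset.induction_on with
  | empty => exact ⟨0, by simp⟩
  | insert a s ha ih =>
    obtain ⟨r, hr⟩ := ih
    obtain ⟨t, ht⟩ := h a
    refine ⟨r + t - r * t, fun c hc => ?_⟩
    rw [nu_sub_smul, nu_add_smul]
    rcases Finset.mem_insert.1 hc with rfl | hc
    · rw [nu_mul_smul, ht]; abel
    · rw [mul_comm, nu_mul_smul, hr c hc]; abel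

variable (R) in
/-- `R`-linear maps. -/
structure NULin (C D : Type*) [AddCommGroup C] [AddCommGroup D] [NUModule R C] [NUModule R D]
    extends C →+ D where
  map_smul' : ∀ (r : R) (c : C), toFun (r • c) = r • toFun c

instance : CoeFun (NULin R C D) fun _ => C → D := ⟨fun f => f.toAddMonoidHom⟩

theorem NULin.map_smul (f : NULin R C D) (r : R) (c : C) : f (r • c) = r • f c := f.map_smul' r c

@[ext] theorem NULin.ext {f g : NULin R C D} (h : ∀ c, f c = g c) : f = g := by
  cases f; cases g; congr 1; exact AddMonoidHom.ext h

/-- The identity map. -/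
def NULin.id (C : Type*) [AddCommGroup C] [NUModule R C] : NULin R C C where
  toAddMonoidHom := AddMonoidHom.id C
  map_smul' _ _ := rfl

/-- The composition of `R`-linear maps. -/
def NULin.comp (g : NULin R D A) (f : NULin R C D) : NULin R C A where
  toAddMonoidHom := g.toAddMonoidHom.comp f.toAddMonoidHom
  map_smul' r c := by
    change g (f (r • c)) = r • g (f c)
    rw [f.map_smul, g.map_smul]

@[simp] theorem NULin.id_apply (c : C) : NULin.id (R := R) C c = c := rfl
@[simp] theorem NULin.comp_apply (g : NULin R D A) (f : NULin R C D) (c : C) :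
    g.comp f c = g (f c) := rfl

open TensorProduct in
variable (R) in
/-- The relations `r c ⊗ d = c ⊗ r d`. -/
def balanceRel (C D : Type*) [AddCommGroup C] [AddCommGroup D] [NUModule R C] [NUModule R D] :
    AddSubgroup (C ⊗[ℤ] D) :=
  AddSubgroup.closure
    {t | ∃ (r : R) (c : C) (d : D), t = (r • c) ⊗ₜ[ℤ] d - c ⊗ₜ[ℤ] (r • d)}

open TensorProduct in
variable (R) in
/-- The tensor product of two modules over the (non-unital) commutative ring `R`: the quotient of
the tensor product of abelian groups by the relations `r c ⊗ d = c ⊗ r d`. -/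
def BTensor (C D : Type*) [AddCommGroup C] [AddCommGroup D] [NUModule R C] [NUModule R D] :
    Type _ :=
  (C ⊗[ℤ] D) ⧸ balanceRel R C D

instance : AddCommGroup (BTensor R C D) :=
  inferInstanceAs (AddCommGroup ((TensorProduct ℤ C D) ⧸ balanceRel R C D))

namespace BTensor

variable (R) in
/-- The pure tensor `c ⊗ d`. -/
def tmul (c : C) (d : D) : BTensor R C D :=
  QuotientAddGroup.mk' (balanceRel R C D) (TensorProduct.tmul ℤ c d)

theorem add_tmul (c c' : C) (d : D) : tmul R (c + c') d = tmul R c d + tmul R c' d := by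
  simp only [tmul, TensorProduct.add_tmul]; exact map_add _ _ _

theorem tmul_add (c : C) (d d' : D) : tmul R c (d + d') = tmul R c d + tmul R c d' := by
  simp only [tmul, TensorProduct.tmul_add]; exact map_add _ _ _

theorem smul_tmul (r : R) (c : C) (d : D) : tmul R (r • c) d = tmul R c (r • d) := by
  rw [← sub_eq_zero]
  refine (map_sub (QuotientAddGroup.mk' (balanceRel R C D)) _ _).symm.trans ?_
  exact (QuotientAddGroup.eq_zero_iff _).2 (AddSubgroup.subset_closure ⟨r, c, d, rfl⟩)

theorem zero_tmul (d : D) : tmul R (0 : C) d = 0 := by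
  simp only [tmul, TensorProduct.zero_tmul]; exact map_zero _

theorem tmul_zero (c : C) : tmul R c (0 : D) = 0 := by
  simp only [tmul, TensorProduct.tmul_zero]; exact map_zero _

theorem induction_on {p : BTensor R C D → Prop} (t : BTensor R C D) (h0 : p 0)
    (h1 : ∀ c d, p (tmul R c d)) (h2 : ∀ s t, p s → p t → p (s + t)) : p t := by
  obtain ⟨t, rfl⟩ := QuotientAddGroup.mk'_surjective (balanceRel R C D) t
  induction t using TensorProduct.induction_on with
  | zero => rw [map_zero]; exact h0
  | tmul c d => exact h1 c d
  | add s t hs ht => rw [map_add]; exact h2 _ _ hs ht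

/-- The additive map out of the tensor product given by a balanced biadditive map. -/
def lift {B : Type*} [AddCommGroup B] (b : C →+ D →+ B)
    (hb : ∀ (r : R) c d, b (r • c) d = b c (r • d)) : BTensor R C D →+ B :=
  QuotientAddGroup.lift (balanceRel R C D)
    (TensorProduct.liftAddHom b (fun n c d => by simp)) (by
      intro t ht
      refine (AddSubgroup.closure_le (K := AddMonoidHom.ker _)).2 ?_ ht
      rintro _ ⟨r, c, d, rfl⟩
      simp [AddMonoidHom.mem_ker, hb])

@[simp] theorem lift_tmul {B : Type*} [AddCommGroup B] (b : C →+ D →+ B)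
    (hb : ∀ (r : R) c d, b (r • c) d = b c (r • d)) (c : C) (d : D) :
    lift b hb (tmul R c d) = b c d := rfl

/-- The biadditive map `(c, d) ↦ c ⊗ d`. -/
def mkHom : C →+ D →+ BTensor R C D :=
  AddMonoidHom.mk' (fun c => AddMonoidHom.mk' (fun d => tmul R c d) (tmul_add c))
    (fun c c' => by ext d; exact add_tmul c c' d)

@[simp] theorem mkHom_apply (c : C) (d : D) : mkHom (R := R) c d = tmul R c d := rfl

theorem hom_ext {B : Type*} [AddCommGroup B] {f g : BTensor R C D →+ B}
    (h : ∀ c d, f (tmul R c d) = g (tmul R c d)) : f = g := by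
  ext t
  induction t using induction_on with
  | h0 => simp
  | h1 c d => exact h c d
  | h2 s t hs ht => simp [hs, ht]

/-- Multiplication by `r` on the tensor product, `r (c ⊗ d) = r c ⊗ d`. -/
def smulMap (r : R) : BTensor R C D →+ BTensor R C D :=
  lift (mkHom.comp (smulHom r)) (fun s c d => by
    simp only [AddMonoidHom.comp_apply, smulHom_apply, mkHom_apply]
    rw [nu_smul_comm, smul_tmul])

@[simp] theorem smulMap_tmul (r : R) (c : C) (d : D) :
    smulMap r (tmul R c d) = tmul R (r • c) d := rfl

/-- The `R`-module structure of the tensor product, `r (c ⊗ d) = r c ⊗ d`. -/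
instance : NUModule R (BTensor R C D) where
  smul r t := smulMap r t
  smul_add' r s t := map_add _ _ _
  add_smul' r s t := by
    refine DFunLike.congr_fun (f := smulMap (r + s)) (g := smulMap r + smulMap s) (hom_ext ?_) t
    intro c d
    simp [nu_add_smul, add_tmul]
  mul_smul' r s t := by
    refine DFunLike.congr_fun (f := smulMap (r * s)) (g := (smulMap r).comp (smulMap s))
      (hom_ext ?_) t
    intro c d
    simp [nu_mul_smul]

theorem smul_def_tmul (r : R) (c : C) (d : D) : r • tmul R c d = tmul R (r • c) d := rfl

/-- The additive map `α ⊗ β` induced by `R`-linear maps `α` and `β`. -/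
def mapHom (α : NULin R C C') (β : NULin R D D') : BTensor R C D →+ BTensor R C' D' :=
  lift (AddMonoidHom.mk' (fun c => (mkHom (α c)).comp β.toAddMonoidHom)
      (fun c c' => by ext d; simp))
    (fun r c d => by
      change tmul R (α (r • c)) (β d) = tmul R (α c) (β (r • d))
      rw [α.map_smul, β.map_smul, smul_tmul])

/-- The `R`-linear map `α ⊗ β` induced by `R`-linear maps `α` and `β`. -/
def map (α : NULin R C C') (β : NULin R D D') : NULin R (BTensor R C D) (BTensor R C' D') where
  toAddMonoidHom := mapHom α β
  map_smul' r t := by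
    refine DFunLike.congr_fun (f := (mapHom α β).comp (smulHom r))
      (g := (smulHom r).comp (mapHom α β)) (hom_ext ?_) t
    intro c d
    change tmul R (α (r • c)) (β d) = r • tmul R (α c) (β d)
    rw [α.map_smul, smul_def_tmul]

@[simp] theorem map_tmul (α : NULin R C C') (β : NULin R D D') (c : C) (d : D) :
    map α β (tmul R c d) = tmul R (α c) (β d) := rfl

theorem map_comp (α' : NULin R C' C'') (β' : NULin R D' D'') (α : NULin R C C')
    (β : NULin R D D') (t : BTensor R C D) :
    map (α'.comp α) (β'.comp β) t = map α' β' (map α β t) := by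
  induction t using induction_on with
  | h0 => simp
  | h1 c d => simp
  | h2 s t hs ht => simp [hs, ht]

theorem map_id (t : BTensor R C D) : map (NULin.id C) (NULin.id D) t = t := by
  induction t using induction_on with
  | h0 => simp
  | h1 c d => simp
  | h2 s t hs ht => simp [hs, ht]

variable (R C) in
/-- The natural map `R ⊗ C → C`, `r ⊗ c ↦ r c` (bijective for a locally unitary module `C`). -/
def leftUnitor : BTensor R R C →+ C :=
  lift (AddMonoidHom.mk' smulHom (fun r s => by ext c; exact nu_add_smul r s c))
    (fun r s c => by
      change (r * s) • c = s • r • c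
      rw [mul_comm, nu_mul_smul])

variable (R C) in
/-- The natural map `C ⊗ R → C`, `c ⊗ r ↦ r c` (bijective for a locally unitary module `C`). -/
def rightUnitor : BTensor R C R →+ C :=
  lift (AddMonoidHom.mk' smulFlip (fun c c' => by ext r; exact nu_smul_add r c c'))
    (fun r c s => by
      change s • r • c = (r * s) • c
      rw [nu_mul_smul, nu_smul_comm])

@[simp] theorem leftUnitor_tmul (r : R) (c : C) : leftUnitor R C (tmul R r c) = r • c := rfl
@[simp] theorem rightUnitor_tmul (c : C) (r : R) : rightUnitor R C (tmul R c r) = r • c := rfl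

end BTensor

end Algebra

section CoalgebraCategory

/-- A coalgebra over a commutative ring `R` (possibly without identity): a locally unitary
`R`-module with a comultiplication and a counit (neither coassociativity nor cocommutativity is
required). -/
structure CoAlg (R : Type v) [NonUnitalCommRing R] where
  carrier : Type u
  [addCommGroup : AddCommGroup carrier]
  [nuModule : NUModule R carrier]
  locallyUnitary : IsLocallyUnitary R carrier
  comul : NULin R carrier (BTensor R carrier carrier)
  counit : NULin R carrier R
  /-- `(ε ⊗ id) ∘ Δ = id`. -/
  counit_comul : ∀ c, BTensor.leftUnitor R carrier (BTensor.map counit (NULin.id _) (comul c)) = c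
  /-- `(id ⊗ ε) ∘ Δ = id`. -/
  comul_counit : ∀ c, BTensor.rightUnitor R carrier (BTensor.map (NULin.id _) counit (comul c)) = c

attribute [instance] CoAlg.addCommGroup CoAlg.nuModule

variable {R : Type v} [NonUnitalCommRing R]

/-- Homomorphisms of `R`-coalgebras. -/
@[ext] structure CoAlg.Hom (C D : CoAlg.{u} R) where
  lin : NULin R C.carrier D.carrier
  comul_lin : ∀ c, D.comul (lin c) = BTensor.map lin lin (C.comul c)
  counit_lin : ∀ c, D.counit (lin c) = C.counit c

/-- The category of `R`-coalgebras. -/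
instance : Category (CoAlg.{u} R) where
  Hom C D := CoAlg.Hom C D
  id C := ⟨NULin.id _, fun c => (BTensor.map_id _).symm, fun _ => rfl⟩
  comp f g := ⟨g.lin.comp f.lin,
    fun c => by rw [BTensor.map_comp, ← f.comul_lin, ← g.comul_lin]; rfl,
    fun c => by rw [← f.counit_lin, ← g.counit_lin]; rfl⟩

end CoalgebraCategory


noncomputable section Functions

variable (n : ℕ) (M : Type*) [TopologicalSpace M] [ChartedSpace (EuclideanSpace ℝ (Fin n)) M]
  (𝕜 : Type) [RCLike 𝕜]

/-- The commutative ring (without identity, unless `M` is compact) of smooth `𝕜`-valued functions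
with compact support on a Hausdorff manifold `M`. -/
def Cc : NonUnitalSubring (M → 𝕜) where
  carrier := {f | ContMDiff (𝓡 n) 𝓘(ℝ, 𝕜) ∞ f ∧ HasCompactSupport f}
  zero_mem' := ⟨contMDiff_const, HasCompactSupport.zero⟩
  add_mem' hf hg := ⟨hf.1.add hg.1, hf.2.add hg.2⟩
  neg_mem' hf := ⟨contDiff_neg.contMDiff.comp hf.1, by
    have := hf.2
    simpa [HasCompactSupport, tsupport, Function.support_neg] using this⟩
  mul_mem' hf hg := ⟨by
    have h : ContDiff ℝ ∞ (fun p : 𝕜 × 𝕜 => p.1 * p.2) := contDiff_fst.mul contDiff_snd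
    exact h.contMDiff.comp (hf.1.prodMk_space hg.1), hf.2.mul_right⟩

variable {n M 𝕜}

theorem Cc.smooth (f : Cc n M 𝕜) : ContMDiff (𝓡 n) 𝓘(ℝ, 𝕜) ∞ f.1 := f.2.1
theorem Cc.compact (f : Cc n M 𝕜) : HasCompactSupport f.1 := f.2.2

@[simp] theorem Cc.add_apply (f g : Cc n M 𝕜) (x : M) : (f + g).1 x = f.1 x + g.1 x := rfl
@[simp] theorem Cc.sub_apply (f g : Cc n M 𝕜) (x : M) : (f - g).1 x = f.1 x - g.1 x := rfl
@[simp] theorem Cc.mul_apply (f g : Cc n M 𝕜) (x : M) : (f * g).1 x = f.1 x * g.1 x := rfl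
@[simp] theorem Cc.zero_apply (x : M) : (0 : Cc n M 𝕜).1 x = 0 := rfl

theorem Cc.eventually_zero (f : Cc n M 𝕜) {x : M} (hx : x ∉ tsupport f.1) :
    ∀ᶠ y in 𝓝 x, f.1 y = 0 := by
  filter_upwards [(isClosed_tsupport f.1).isOpen_compl.mem_nhds hx] with y hy
  exact image_eq_zero_of_notMem_tsupport hy

variable [IsManifold (𝓡 n) ∞ M] [T2Space M]

/-- Smooth bump functions. -/
theorem exists_bump (𝕜 : Type) [RCLike 𝕜] (x : M) {W : Set M} (hW : W ∈ 𝓝 x) :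
    ∃ f : Cc n M 𝕜, tsupport f.1 ⊆ W ∧ ∀ᶠ y in 𝓝 x, f.1 y = 1 := by
  obtain ⟨ψ, -, hψ⟩ := (SmoothBumpFunction.nhds_basis_tsupport (I := 𝓡 n) x).mem_iff.1 hW
  have hsub : tsupport (fun y => ((ψ y : ℝ) : 𝕜)) ⊆ tsupport ψ := by
    refine closure_mono fun y hy => ?_
    simpa using hy
  refine ⟨⟨fun y => ((ψ y : ℝ) : 𝕜), ?_, ?_⟩, hsub.trans hψ, ?_⟩
  · exact (RCLike.ofRealCLM (K := 𝕜)).contDiff.contMDiff.comp ψ.contMDiff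
  · exact ψ.hasCompactSupport.of_isClosed_subset (isClosed_tsupport _) hsub
  · filter_upwards [ψ.eventuallyEq_one] with y hy
    simp [hy]

/-- Smooth functions that equal one on a given compact set. -/
theorem exists_eq_one (𝕜 : Type) [RCLike 𝕜] {K W : Set M} (hK : IsCompact K) (hW : IsOpen W)
    (hKW : K ⊆ W) : ∃ f : Cc n M 𝕜, tsupport f.1 ⊆ W ∧ ∀ y ∈ K, f.1 y = 1 := by
  have h : ∃ f : Cc n M 𝕜, tsupport f.1 ⊆ W ∧ ∀ y ∈ K, f.1 y = 1 := by
    refine hK.induction_on (p := fun S => ∃ f : Cc n M 𝕜, tsupport f.1 ⊆ W ∧ ∀ y ∈ S, f.1 y = 1)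
      ?_ ?_ ?_ ?_
    · refine ⟨0, ?_, by simp⟩
      have : tsupport (0 : Cc n M 𝕜).1 = ∅ := by
        rw [tsupport_eq_empty_iff]; rfl
      rw [this]; exact Set.empty_subset _
    · rintro s t hst ⟨f, hf, hf'⟩
      exact ⟨f, hf, fun y hy => hf' y (hst hy)⟩
    · rintro s t ⟨f, hf, hf'⟩ ⟨g, hg, hg'⟩
      refine ⟨f + g - f * g, ?_, ?_⟩
      · refine (closure_minimal (t := tsupport f.1 ∪ tsupport g.1) ?_
          ((isClosed_tsupport _).union (isClosed_tsupport _))).trans (Set.union_subset hf hg)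
        intro y hy
        by_contra hc
        rw [Set.mem_union, not_or] at hc
        apply hy
        simp [image_eq_zero_of_notMem_tsupport hc.1, image_eq_zero_of_notMem_tsupport hc.2]
      · rintro y (hy | hy)
        · simp [hf' y hy]
        · simp [hg' y hy]
    · intro x hx
      obtain ⟨f, hf, hf1⟩ := exists_bump (n := n) 𝕜 x (hW.mem_nhds (hKW hx))
      exact ⟨_, mem_nhdsWithin_of_mem_nhds hf1, f, hf, fun y hy => hy⟩
  exact h

/-- Every `f` with support in an open set `W` has a local identity with support in `W`. -/
theorem exists_local_unit (f : Cc n M 𝕜) {W : Set M} (hW : IsOpen W) (hf : tsupport f.1 ⊆ W) :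
    ∃ η : Cc n M 𝕜, tsupport η.1 ⊆ W ∧ η * f = f := by
  obtain ⟨η, h1, h2⟩ := exists_eq_one (n := n) 𝕜 (Cc.compact f) hW hf
  refine ⟨η, h1, ?_⟩
  ext y
  by_cases hy : y ∈ tsupport f.1
  · simp [h2 y hy]
  · simp [image_eq_zero_of_notMem_tsupport hy]

end Functions


noncomputable section Etale

variable {n : ℕ} {M : Type u} [TopologicalSpace M] [ChartedSpace (EuclideanSpace ℝ (Fin n)) M]

/-! ### The smooth structure on the total space of a local homeomorphism -/

variable {E : Type*} [TopologicalSpace E] {π : E → M}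

/-- The charts of `M`, transported to `E` along a local homeomorphism `E → M`. -/
@[reducible] def etaleCharted (hπ : IsLocalHomeomorph π) :
    ChartedSpace (EuclideanSpace ℝ (Fin n)) E where
  atlas := {e | ∃ y : E, e = (hπ.localInverseAt y).symm.trans (chartAt _ (π y))}
  chartAt y := (hπ.localInverseAt y).symm.trans (chartAt _ (π y))
  mem_chart_source y := by simp
  chart_mem_atlas y := ⟨y, rfl⟩

theorem etale_isManifold [IsManifold (𝓡 n) ∞ M] (hπ : IsLocalHomeomorph π) :
    letI := etaleCharted (n := n) hπ
    IsManifold (𝓡 n) ∞ E := by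
  let _ := etaleCharted (n := n) hπ
  refine isManifold_of_contDiffOn (𝓡 n) ∞ E ?_
  rintro _ _ ⟨y, rfl⟩ ⟨y', rfl⟩
  have h := (contDiffGroupoid ∞ (𝓡 n)).compatible
    (chart_mem_atlas (EuclideanSpace ℝ (Fin n)) (π y))
    (chart_mem_atlas (EuclideanSpace ℝ (Fin n)) (π y'))
  rw [contDiffGroupoid, mem_groupoid_of_pregroupoid] at h
  refine (ContDiffOn.mono h.1 ?_).congr ?_
  all_goals
    intro z hz
    simp at hz
    have e1 : ∀ w ∈ (hπ.localInverseAt y).source, π (hπ.localInverseAt y w) = w :=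
      fun w hw => hπ.apply_localInverseAt_of_mem hw
    simp [hz, e1]
  grind

theorem etale_isLocalDiffeomorph [IsManifold (𝓡 n) ∞ M] (hπ : IsLocalHomeomorph π) :
    letI := etaleCharted (n := n) hπ
    IsLocalDiffeomorph (𝓡 n) (𝓡 n) ∞ π := by
  let _ := etaleCharted (n := n) hπ
  have _ := etale_isManifold (n := n) hπ
  intro y
  let c := chartAt (EuclideanSpace ℝ (Fin n)) (π y)
  let d := chartAt (EuclideanSpace ℝ (Fin n)) y
  have hd : d = (hπ.localInverseAt y).symm.trans c := rfl
  let g := d.trans c.symm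
  refine ⟨⟨g.toPartialEquiv, g.open_source, g.open_target, ?_, ?_⟩, ?_, ?_⟩
  · refine (contMDiffOn_chart_symm (n := ∞) (I := 𝓡 n) (x := π y)).comp
      ((contMDiffOn_chart (n := ∞) (I := 𝓡 n) (x := y)).mono ?_) ?_
    · intro z hz; exact hz.1
    · intro z hz; exact hz.2
  · refine (contMDiffOn_chart_symm (n := ∞) (I := 𝓡 n) (x := y)).comp
      ((contMDiffOn_chart (n := ∞) (I := 𝓡 n) (x := π y)).mono ?_) ?_
    · intro z hz; exact hz.1
    · intro z hz; exact hz.2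
  · exact ⟨mem_chart_source _ y, (d.map_source (mem_chart_source _ y)).1⟩
  · intro z hz
    change π z = c.symm (d z)
    have hz' : z ∈ d.source := hz.1
    simp [hd] at hz' ⊢
    rw [c.left_inv hz'.2]

end Etale

noncomputable section Sheaves

variable (n : ℕ) (M : Type u) [TopologicalSpace M] [ChartedSpace (EuclideanSpace ℝ (Fin n)) M]

/-- A sheaf (of sets) on `M`: a local diffeomorphism `π : E → M` from a (not necessarily Hausdorff)
manifold `E`. -/
structure Sh where
  Total : Type u
  [topologicalSpace : TopologicalSpace Total]
  [chartedSpace : ChartedSpace (EuclideanSpace ℝ (Fin n)) Total]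
  [isManifold : IsManifold (𝓡 n) ∞ Total]
  proj : Total → M
  isLocalDiffeomorph : IsLocalDiffeomorph (𝓡 n) (𝓡 n) ∞ proj

attribute [instance] Sh.topologicalSpace Sh.chartedSpace Sh.isManifold

variable {n M}

/-- Morphisms of sheaves: smooth maps over `M`. -/
@[ext] structure Sh.Hom (E F : Sh n M) where
  toFun : E.Total → F.Total
  smooth : ContMDiff (𝓡 n) (𝓡 n) ∞ toFun
  proj_toFun : ∀ y, F.proj (toFun y) = E.proj y

/-- The category of sheaves on `M`. -/
instance : Category (Sh n M) where
  Hom E F := Sh.Hom E F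
  id E := ⟨fun y => y, contMDiff_id, fun _ => rfl⟩
  comp f g := ⟨fun y => g.toFun (f.toFun y), g.smooth.comp f.smooth,
    fun y => by rw [g.proj_toFun, f.proj_toFun]⟩

theorem Sh.isLocalHomeomorph (E : Sh n M) : IsLocalHomeomorph E.proj :=
  E.isLocalDiffeomorph.isLocalHomeomorph

theorem Sh.Hom.isLocalHomeomorph {E F : Sh n M} (φ : Sh.Hom E F) :
    IsLocalHomeomorph φ.toFun := by
  refine IsLocalHomeomorph.of_comp (g := F.proj) ?_ F.isLocalHomeomorph φ.smooth.continuous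
  have : F.proj ∘ φ.toFun = E.proj := funext φ.proj_toFun
  rw [this]; exact E.isLocalHomeomorph

/-- A continuous map over `M` between sheaves is smooth. -/
def Sh.homOfContinuous {E F : Sh n M} (φ : E.Total → F.Total) (hφ : Continuous φ)
    (h : ∀ y, F.proj (φ y) = E.proj y) : Sh.Hom E F where
  toFun := φ
  smooth := by
    intro y
    obtain ⟨Φ, hy, he⟩ := F.isLocalDiffeomorph (φ y)
    have hU : ∀ᶠ z in 𝓝 y, φ z ∈ Φ.source :=
      hφ.continuousAt.eventually (Φ.open_source.mem_nhds hy)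
    have h1 : φ =ᶠ[𝓝 y] Φ.invFun ∘ E.proj := by
      filter_upwards [hU] with z hz
      have : Φ.toFun (φ z) = E.proj z := by rw [← h z]; exact (he hz).symm
      change φ z = Φ.invFun (E.proj z)
      rw [← this]
      exact (Φ.left_inv' hz).symm
    refine ContMDiffAt.congr_of_eventuallyEq ?_ h1
    refine ContMDiffAt.comp y ?_ E.isLocalDiffeomorph.contMDiff.contMDiffAt
    refine Φ.contMDiffOn_invFun.contMDiffAt (Φ.open_target.mem_nhds ?_)
    have : Φ.toFun (φ y) = E.proj y := by rw [← h y]; exact (he hy).symm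
    rw [← this]
    exact Φ.map_source' hy
  proj_toFun := h

/-- The sheaf on `M` given by a local homeomorphism, with the unique smooth structure for which
it is a local diffeomorphism. -/
def Sh.ofEtale [IsManifold (𝓡 n) ∞ M] {E : Type u} [TopologicalSpace E] (π : E → M)
    (hπ : IsLocalHomeomorph π) : Sh n M :=
  letI := etaleCharted (n := n) hπ
  haveI := etale_isManifold (n := n) hπ
  { Total := E, proj := π, isLocalDiffeomorph := etale_isLocalDiffeomorph hπ }

/-- A continuous, open, locally injective map is a local homeomorphism. -/
theorem isLocalHomeomorph_of_open {X Y : Type*} [TopologicalSpace X] [TopologicalSpace Y]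
    {f : X → Y} (hc : Continuous f) (ho : IsOpenMap f)
    (hi : ∀ x, ∃ U : Set X, IsOpen U ∧ x ∈ U ∧ Set.InjOn f U) : IsLocalHomeomorph f := by
  rw [isLocalHomeomorph_iff_isOpenEmbedding_restrict]
  intro x
  obtain ⟨U, hU, hx, hinj⟩ := hi x
  exact ⟨U, hU.mem_nhds hx, Topology.IsOpenEmbedding.of_continuous_injective_isOpenMap
    (hc.comp continuous_subtype_val) hinj.injective (ho.domRestrict hU)⟩

/-- The underlying space of the fibred product `E ×_M F`. -/
abbrev Sh.FibreProd (E F : Sh n M) : Type u :=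
  {p : E.Total × F.Total // E.proj p.1 = F.proj p.2}

theorem Sh.fibreProd_isLocalHomeomorph (E F : Sh n M) :
    IsLocalHomeomorph (fun p : Sh.FibreProd E F => E.proj p.1.1) := by
  have hE := E.isLocalHomeomorph
  have hF := F.isLocalHomeomorph
  refine isLocalHomeomorph_of_open
    (hE.continuous.comp (continuous_fst.comp continuous_subtype_val)) ?_ ?_
  · rw [isOpenMap_iff_nhds_le]
    rintro ⟨⟨y, z⟩, h⟩ S hS
    obtain ⟨T, hT, hTS⟩ := (mem_nhds_subtype _ _ _).1 hS
    have hT' : T ∈ 𝓝 y ×ˢ 𝓝 z := by rwa [← nhds_prod_eq]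
    obtain ⟨T1, h1, T2, h2, h12⟩ := Filter.mem_prod_iff.1 hT'
    have hs : Tendsto (hE.localInverseAt y) (𝓝 (E.proj y)) (𝓝 y) := by
      have := (hE.localInverseAt y).continuousAt hE.apply_self_mem_localInverseAt_source
      simpa [ContinuousAt] using this
    have ht : Tendsto (hF.localInverseAt z) (𝓝 (E.proj y)) (𝓝 z) := by
      have := (hF.localInverseAt z).continuousAt hF.apply_self_mem_localInverseAt_source
      rw [show E.proj y = F.proj z from h]
      simpa [ContinuousAt] using this
    have m1 : (hE.localInverseAt y).source ∈ 𝓝 (E.proj y) :=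
      (hE.localInverseAt y).open_source.mem_nhds hE.apply_self_mem_localInverseAt_source
    have m2 : (hF.localInverseAt z).source ∈ 𝓝 (E.proj y) := by
      rw [show E.proj y = F.proj z from h]
      exact (hF.localInverseAt z).open_source.mem_nhds hF.apply_self_mem_localInverseAt_source
    change S ∈ 𝓝 (E.proj y)
    filter_upwards [hs h1, ht h2, m1, m2] with x hx1 hx2 hx3 hx4
    have e1 := hE.apply_localInverseAt_of_mem hx3
    have e2 := hF.apply_localInverseAt_of_mem hx4
    have := @hTS ⟨⟨hE.localInverseAt y x, hF.localInverseAt z x⟩, e1.trans e2.symm⟩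
      (h12 ⟨hx1, hx2⟩)
    change E.proj (hE.localInverseAt y x) ∈ S at this
    rwa [e1] at this
  · rintro ⟨⟨y, z⟩, h⟩
    refine ⟨{p | p.1.1 ∈ (hE.localInverseAt y).target ∧ p.1.2 ∈ (hF.localInverseAt z).target},
      ?_, ⟨by simp, by simp⟩, ?_⟩
    · exact ((hE.localInverseAt y).open_target.preimage
        (continuous_fst.comp continuous_subtype_val)).inter
        ((hF.localInverseAt z).open_target.preimage (continuous_snd.comp continuous_subtype_val))
    · rintro ⟨⟨a, b⟩, hab⟩ ⟨ha, hb⟩ ⟨⟨a', b'⟩, hab'⟩ ⟨ha', hb'⟩ heq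
      have e1 : a = a' := hE.injOn_localInverseAt_target ha ha' heq
      have e2 : b = b' := hF.injOn_localInverseAt_target hb hb' (by
        rw [← show E.proj a = F.proj b from hab, ← show E.proj a' = F.proj b' from hab']
        exact heq)
      subst e1 e2; rfl

variable [IsManifold (𝓡 n) ∞ M]

/-- The fibred product `E ×_M F` of two sheaves on `M`, as a sheaf on `M`. -/
def Sh.prod (E F : Sh n M) : Sh n M :=
  Sh.ofEtale (fun p : Sh.FibreProd E F => E.proj p.1.1) (Sh.fibreProd_isLocalHomeomorph E F)

/-- The diagonal `E → E ×_M E`. -/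
def Sh.diag (E : Sh n M) : Sh.Hom E (E.prod E) :=
  Sh.homOfContinuous (F := E.prod E) (fun y => (⟨(y, y), rfl⟩ : Sh.FibreProd E E))
    ((continuous_id.prodMk continuous_id).subtype_mk _) (fun _ => rfl)

end Sheaves


noncomputable section SheafFunctions

open scoped Classical in
/-- The extension by zero `f|_U^E` of `f : U → 𝕜`, as a section of germs on `E`. -/
def extGerm {E 𝕜 : Type*} [TopologicalSpace E] [Zero 𝕜] (U : Set E) (f : U → 𝕜) :
    ∀ y : E, Germ (𝓝 y) 𝕜 :=
  fun y => if y ∈ U then ((Function.extend Subtype.val f 0 : E → 𝕜) : Germ (𝓝 y) 𝕜) else 0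

/-- The smooth functions with compact support on a not necessarily Hausdorff manifold `E`: the sums
of extensions by zero of smooth functions with compact support in Hausdorff open subsets of `E`,
inside the (not necessarily continuous) sections of germs of functions on `E`. -/
def CcSec (n : ℕ) (E : Type*) [TopologicalSpace E] [ChartedSpace (EuclideanSpace ℝ (Fin n)) E]
    (𝕜 : Type) [RCLike 𝕜] : AddSubgroup (∀ y : E, Germ (𝓝 y) 𝕜) :=
  AddSubgroup.closure {u | ∃ (U : TopologicalSpace.Opens E) (f : Cc n U 𝕜),
    T2Space U ∧ u = extGerm (U : Set E) f.1}

/-- The pushforward `φ_{*y}` of germs along a local homeomorphism (inverse to the pullback). -/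
def pushGerm {E F 𝕜 : Type*} [TopologicalSpace E] [TopologicalSpace F] {φ : E → F}
    (hφ : IsLocalHomeomorph φ) {y : E} {z : F} (h : φ y = z) (g : Germ (𝓝 y) 𝕜) :
    Germ (𝓝 z) 𝕜 :=
  g.compTendsto (hφ.localInverseAt y) (by
    have := (hφ.localInverseAt y).continuousAt hφ.apply_self_mem_localInverseAt_source
    subst h
    simpa [ContinuousAt] using this)

/-- The pushforward `φ_+(u)_z = ∑_{y ∈ φ⁻¹(z)} φ_{*y}(u_y)`. -/
def pushSec {E F 𝕜 : Type*} [TopologicalSpace E] [TopologicalSpace F] [AddCommMonoid 𝕜]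
    {φ : E → F} (hφ : IsLocalHomeomorph φ) (u : ∀ y : E, Germ (𝓝 y) 𝕜) :
    ∀ z : F, Germ (𝓝 z) 𝕜 :=
  fun z => ∑ᶠ y : {y : E // φ y = z}, pushGerm hφ y.2 (u y.1)

section Germs

variable {E F 𝕜 : Type*} [TopologicalSpace E] [TopologicalSpace F] {φ : E → F}

theorem pushGerm_comp (hφ : IsLocalHomeomorph φ) {y : E} {z : F} (h : φ y = z) (f : F → 𝕜) :
    pushGerm hφ h ((f ∘ φ : E → 𝕜) : Germ (𝓝 y) 𝕜) = (f : Germ (𝓝 z) 𝕜) := by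
  subst h
  refine Quotient.sound ?_
  change ∀ᶠ x in 𝓝 (φ y), (f ∘ φ) (hφ.localInverseAt y x) = f x
  filter_upwards [(hφ.localInverseAt y).open_source.mem_nhds
    hφ.apply_self_mem_localInverseAt_source] with x hx
  simp [hφ.apply_localInverseAt_of_mem hx]

theorem pushGerm_zero [Zero 𝕜] (hφ : IsLocalHomeomorph φ) {y : E} {z : F} (h : φ y = z) :
    pushGerm hφ h (0 : Germ (𝓝 y) 𝕜) = 0 := rfl

theorem pushGerm_add [Add 𝕜] (hφ : IsLocalHomeomorph φ) {y : E} {z : F} (h : φ y = z)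
    (g g' : Germ (𝓝 y) 𝕜) : pushGerm hφ h (g + g') = pushGerm hφ h g + pushGerm hφ h g' := by
  induction g using Germ.inductionOn with | _ g =>
  induction g' using Germ.inductionOn with | _ g' =>
  rfl

end Germs

variable {n : ℕ} {M : Type u} [TopologicalSpace M] [ChartedSpace (EuclideanSpace ℝ (Fin n)) M]
  {𝕜 : Type} [RCLike 𝕜]

/-! ### Functions supported in elementary subsets -/

open scoped Classical in
/-- The extension by zero of `f ∘ π|_U`. -/
def el (E : Sh n M) (U : Set E.Total) (f : Cc n M 𝕜) : ∀ y : E.Total, Germ (𝓝 y) 𝕜 :=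
  fun y => if y ∈ U then ((f.1 ∘ E.proj : E.Total → 𝕜) : Germ (𝓝 y) 𝕜) else 0

/-- `U` is elementary and `f` has support in the image of `U`. -/
structure IsEl (E : Sh n M) (U : Set E.Total) (f : Cc n M 𝕜) : Prop where
  isOpen : IsOpen U
  injOn : Set.InjOn E.proj U
  supp : tsupport f.1 ⊆ E.proj '' U

theorem el_mem {E : Sh n M} {U : Set E.Total} (f : Cc n M 𝕜) {y : E.Total} (hy : y ∈ U) :
    el E U f y = ((f.1 ∘ E.proj : E.Total → 𝕜) : Germ (𝓝 y) 𝕜) := if_pos hy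

theorem el_not_mem {E : Sh n M} {U : Set E.Total} (f : Cc n M 𝕜) {y : E.Total} (hy : y ∉ U) :
    el E U f y = 0 := if_neg hy

/-- Elementary neighbourhoods exist. -/
theorem exists_elementary (E : Sh n M) (y : E.Total) :
    ∃ U : Set E.Total, IsOpen U ∧ y ∈ U ∧ Set.InjOn E.proj U :=
  ⟨(E.isLocalHomeomorph.localInverseAt y).target,
    (E.isLocalHomeomorph.localInverseAt y).open_target, by simp,
    E.isLocalHomeomorph.injOn_localInverseAt_target⟩

theorem IsEl.el_mem_CcSec [T2Space M] {E : Sh n M} {U : Set E.Total} {f : Cc n M 𝕜}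
    (h : IsEl E U f) : el E U f ∈ CcSec n E.Total 𝕜 := by
  let V : TopologicalSpace.Opens E.Total := ⟨U, h.isOpen⟩
  let q : V → M := fun y => E.proj y.1
  have hq : Topology.IsOpenEmbedding q :=
    Topology.IsOpenEmbedding.of_continuous_injective_isOpenMap
      (E.isLocalHomeomorph.continuous.comp continuous_subtype_val) h.injOn.injective
      (E.isLocalHomeomorph.isOpenMap.domRestrict h.isOpen)
  have hsupp : tsupport (f.1 ∘ q) = q ⁻¹' tsupport f.1 := by
    rw [tsupport, tsupport, hq.isOpenMap.preimage_closure_eq_closure_preimage hq.continuous]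
    rfl
  have hV : T2Space V := hq.isEmbedding.t2Space
  let g : Cc n V 𝕜 := ⟨f.1 ∘ q, by
    refine ⟨(Cc.smooth f).comp (E.isLocalDiffeomorph.contMDiff.comp contMDiff_subtype_val), ?_⟩
    rw [HasCompactSupport, hsupp]
    refine hq.isInducing.isCompact_preimage_iff ?_ |>.2 (Cc.compact f)
    intro x hx
    obtain ⟨y, hy, rfl⟩ := h.supp hx
    exact ⟨⟨y, hy⟩, rfl⟩⟩
  refine AddSubgroup.subset_closure ⟨V, g, hV, ?_⟩
  funext y
  by_cases hy : y ∈ U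
  · rw [el_mem f hy, extGerm, if_pos (show y ∈ (V : Set E.Total) from hy)]
    refine Quotient.sound ?_
    filter_upwards [h.isOpen.mem_nhds hy] with w hw
    exact (Subtype.val_injective.extend_apply g.1 0 (⟨w, hw⟩ : V)).symm
  · rw [el_not_mem f hy, extGerm, if_neg (show y ∉ (V : Set E.Total) from hy)]

open scoped Classical in
/-- A function supported in an elementary subset comes from a function on the base. -/
theorem exists_el_of_supp [T2Space M] {E : Sh n M} {U : TopologicalSpace.Opens E.Total}
    (f : Cc n U 𝕜) {V : Set E.Total} (hV : IsOpen V) (hinj : Set.InjOn E.proj V)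
    (hVU : V ⊆ U) (hf : Subtype.val '' tsupport f.1 ⊆ V) :
    ∃ F : Cc n M 𝕜, IsEl E V F ∧ extGerm (U : Set E.Total) f.1 = el E V F := by
  set K : Set E.Total := Subtype.val '' tsupport f.1 with hK
  have hKc : IsCompact K := (Cc.compact f).isCompact.image continuous_subtype_val
  set g : E.Total → 𝕜 := Function.extend Subtype.val f.1 0 with hg
  have hgU : ∀ y : U, g y.1 = f.1 y := fun y => Subtype.val_injective.extend_apply f.1 0 y
  have hgK : ∀ y, y ∉ K → g y = 0 := by
    intro y hy
    by_cases hyU : y ∈ U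
    · rw [hgU ⟨y, hyU⟩]
      exact image_eq_zero_of_notMem_tsupport fun hc => hy ⟨_, hc, rfl⟩
    · exact Function.extend_apply' _ _ _ (by rintro ⟨a, rfl⟩; exact hyU a.2)
  let F : M → 𝕜 := fun x => if h : ∃ y ∈ V, E.proj y = x then g h.choose else 0
  have hF : ∀ y ∈ V, F (E.proj y) = g y := by
    intro y hy
    have h : ∃ y' ∈ V, E.proj y' = E.proj y := ⟨y, hy, rfl⟩
    simp only [F, dif_pos h]
    rw [hinj h.choose_spec.1 hy h.choose_spec.2]
  have hF0 : ∀ x, x ∉ E.proj '' K → F x = 0 := by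
    intro x hx
    by_cases h : ∃ y ∈ V, E.proj y = x
    · obtain ⟨y, hy, rfl⟩ := h
      rw [hF y hy]
      exact hgK y fun hc => hx ⟨y, hc, rfl⟩
    · simp only [F, dif_neg h]
  have hKc' : IsCompact (E.proj '' K) := hKc.image E.isLocalHomeomorph.continuous
  have hts : tsupport F ⊆ E.proj '' K := by
    refine closure_minimal (fun x hx => ?_) hKc'.isClosed
    by_contra hc
    exact hx (hF0 x hc)
  have hFs : ContMDiff (𝓡 n) 𝓘(ℝ, 𝕜) ∞ F := by
    refine contMDiff_of_tsupport fun x hx => ?_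
    obtain ⟨y, hy, rfl⟩ := hts hx
    obtain ⟨Φ, hyΦ, he⟩ := E.isLocalDiffeomorph y
    have hΦy : Φ.toFun y = E.proj y := (he hyΦ).symm
    have hyt : E.proj y ∈ Φ.target := hΦy ▸ Φ.map_source' hyΦ
    have hinv : Φ.invFun (E.proj y) = y := by rw [← hΦy]; exact Φ.left_inv' hyΦ
    have hsm : ContMDiffAt (𝓡 n) (𝓡 n) ∞ Φ.invFun (E.proj y) :=
      Φ.contMDiffOn_invFun.contMDiffAt (Φ.open_target.mem_nhds hyt)
    have hgs : ContMDiffAt (𝓡 n) 𝓘(ℝ, 𝕜) ∞ g (Φ.invFun (E.proj y)) := by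
      rw [hinv]
      refine (contMDiffAt_subtype_iff (U := U) (x := ⟨y, hVU (hf hy)⟩)).1 ?_
      have : (fun x : U => g x) = f.1 := funext hgU
      rw [this]
      exact (Cc.smooth f).contMDiffAt
    refine (hgs.comp (E.proj y) hsm).congr_of_eventuallyEq ?_
    have hVn : ∀ᶠ x in 𝓝 (E.proj y), Φ.invFun x ∈ V := by
      refine hsm.continuousAt.eventually (hV.mem_nhds ?_)
      rw [hinv]; exact hf hy
    filter_upwards [hVn, Φ.open_target.mem_nhds hyt] with x hx hxt
    have h1 : Φ.invFun x ∈ Φ.source := Φ.map_target' hxt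
    have h2 : E.proj (Φ.invFun x) = x := (he h1).trans (Φ.right_inv' hxt)
    have := hF _ hx
    rw [h2] at this
    exact this
  refine ⟨⟨F, hFs, hKc'.of_isClosed_subset (isClosed_tsupport _) hts⟩,
    ⟨hV, hinj, hts.trans (Set.image_mono hf)⟩, ?_⟩
  funext y
  by_cases hy : y ∈ V
  · rw [el_mem _ hy, extGerm, if_pos (show y ∈ (U : Set E.Total) from hVU hy)]
    refine Quotient.sound ?_
    filter_upwards [hV.mem_nhds hy] with w hw
    exact (hF w hw).symm
  · rw [el_not_mem _ hy, extGerm]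
    by_cases hyU : y ∈ (U : Set E.Total)
    · rw [if_pos hyU]
      have h1 : (⟨y, hyU⟩ : U) ∉ tsupport f.1 := fun hc => hy (hf ⟨_, hc, rfl⟩)
      have h2 := Cc.eventually_zero f h1
      refine Quotient.sound ?_
      have h3 : ∀ᶠ w in 𝓝 y, ∀ hw : w ∈ U, f.1 ⟨w, hw⟩ = 0 := by
        rw [nhds_subtype_eq_comap, eventually_comap] at h2
        filter_upwards [h2] with w hw hwU
        exact hw ⟨w, hwU⟩ rfl
      filter_upwards [h3, U.2.mem_nhds hyU] with w hw hwU
      change g w = 0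
      rw [← hw hwU]
      exact hgU ⟨w, hwU⟩
    · rw [if_neg hyU]


theorem extGerm_add {E : Type*} [TopologicalSpace E] (U : Set E) (f g : U → 𝕜) :
    extGerm U (f + g) = extGerm U f + extGerm U g := by
  funext y
  by_cases hy : y ∈ U
  · simp only [extGerm, if_pos hy, Pi.add_apply]
    rw [← Germ.coe_add, ← Function.extend_add, add_zero]
  · simp [extGerm, if_neg hy]

theorem extGerm_neg {E : Type*} [TopologicalSpace E] (U : Set E) (f : U → 𝕜) :
    extGerm U (-f) = - extGerm U f := by
  funext y
  by_cases hy : y ∈ U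
  · simp only [extGerm, if_pos hy, Pi.neg_apply]
    rw [← Germ.coe_neg, ← Function.extend_neg, neg_zero]
  · simp [extGerm, if_neg hy]

theorem el_neg (E : Sh n M) (U : Set E.Total) (f : Cc n M 𝕜) : el E U (-f) = - el E U f := by
  funext y
  by_cases hy : y ∈ U
  · rw [Pi.neg_apply, el_mem _ hy, el_mem _ hy]; rfl
  · rw [Pi.neg_apply, el_not_mem _ hy, el_not_mem _ hy, neg_zero]

theorem IsEl.neg {E : Sh n M} {U : Set E.Total} {f : Cc n M 𝕜} (h : IsEl E U f) :
    IsEl E U (-f) := by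
  refine ⟨h.isOpen, h.injOn, ?_⟩
  have : tsupport (-f).1 = tsupport f.1 := by
    change tsupport (-(f.1)) = _
    simp [tsupport, Function.support_neg]
  rw [this]; exact h.supp

/-- The functions supported in elementary subsets span all the functions. -/
theorem CcSec_eq [T2Space M] (E : Sh n M) : CcSec n E.Total 𝕜 =
    AddSubgroup.closure {u | ∃ (U : Set E.Total) (f : Cc n M 𝕜), IsEl E U f ∧ u = el E U f} := by
  refine le_antisymm ?_ ?_
  · refine (AddSubgroup.closure_le _).2 ?_
    rintro _ ⟨U, f, hU, rfl⟩
    set S := AddSubgroup.closure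
      {u | ∃ (U : Set E.Total) (f : Cc n M 𝕜), IsEl E U f ∧ u = el E U f} with hS
    have key : ∃ ρ : Cc n U 𝕜, (∀ y ∈ tsupport f.1, ρ.1 y = 1) ∧
        ∀ g : Cc n U 𝕜, extGerm (U : Set E.Total) (ρ * g).1 ∈ S := by
      refine (Cc.compact f).isCompact.induction_on
        (p := fun K => ∃ ρ : Cc n U 𝕜, (∀ y ∈ K, ρ.1 y = 1) ∧
          ∀ g : Cc n U 𝕜, extGerm (U : Set E.Total) (ρ * g).1 ∈ S) ?_ ?_ ?_ ?_
      · refine ⟨0, by simp, fun g => ?_⟩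
        rw [zero_mul]
        convert S.zero_mem
        have := extGerm_add (U : Set E.Total) (0 : U → 𝕜) 0
        simpa using this
      · rintro s t hst ⟨ρ, h1, h2⟩
        exact ⟨ρ, fun y hy => h1 y (hst hy), h2⟩
      · rintro s t ⟨ρ, h1, h2⟩ ⟨σ, h3, h4⟩
        refine ⟨ρ + σ - ρ * σ, ?_, fun g => ?_⟩
        · rintro y (hy | hy)
          · simp [h1 y hy]
          · simp [h3 y hy]
        · have e : ((ρ + σ - ρ * σ) * g).1 = (ρ * g).1 + (σ * g).1 + -(ρ * (σ * g)).1 := by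
            funext y
            simp
            ring
          rw [e, extGerm_add, extGerm_add, extGerm_neg]
          exact S.add_mem (S.add_mem (h2 g) (h4 g)) (S.neg_mem (h2 _))
      · intro x hx
        obtain ⟨V, hV, hxV, hinj⟩ := exists_elementary E x.1
        obtain ⟨ρ, h1, h2⟩ := exists_bump (n := n) 𝕜 x
          ((hV.preimage continuous_subtype_val).mem_nhds hxV)
        refine ⟨_, mem_nhdsWithin_of_mem_nhds h2, ρ, fun y hy => hy, fun g => ?_⟩
        obtain ⟨F, hF, hF'⟩ := exists_el_of_supp (E := E) (ρ * g) (hV.inter U.2)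
          (hinj.mono Set.inter_subset_left) Set.inter_subset_right (by
            rintro _ ⟨y, hy, rfl⟩
            refine ⟨h1 (closure_mono ?_ hy), y.2⟩
            intro z hz
            simp only [Function.mem_support, Cc.mul_apply] at hz
            exact left_ne_zero_of_mul hz)
        rw [hF']
        exact AddSubgroup.subset_closure ⟨_, F, hF, rfl⟩
    obtain ⟨ρ, h1, h2⟩ := key
    have : ρ * f = f := by
      ext y
      by_cases hy : y ∈ tsupport f.1
      · simp [h1 y hy]
      · simp [image_eq_zero_of_notMem_tsupport hy]
    have h3 := h2 f
    rwa [this] at h3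
  · refine (AddSubgroup.closure_le _).2 ?_
    rintro _ ⟨U, f, h, rfl⟩
    exact h.el_mem_CcSec

variable [T2Space M]

variable (𝕜) in
/-- The smooth functions with compact support on the total space of a sheaf `E` on `M`. -/
def Sh.Fn (E : Sh n M) : Type u := CcSec n E.Total 𝕜

instance (E : Sh n M) : AddCommGroup (E.Fn 𝕜) :=
  inferInstanceAs (AddCommGroup (CcSec n E.Total 𝕜))

/-- The section of germs underlying an element of `E.Fn 𝕜`. -/
def Sh.Fn.sec {E : Sh n M} : E.Fn 𝕜 →+ (∀ y : E.Total, Germ (𝓝 y) 𝕜) :=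
  (CcSec n E.Total 𝕜).subtype

theorem Sh.Fn.ext {E : Sh n M} {u v : E.Fn 𝕜} (h : u.sec = v.sec) : u = v := Subtype.ext h

theorem Sh.Fn.sec_mem {E : Sh n M} (u : E.Fn 𝕜) : u.sec ∈ CcSec n E.Total 𝕜 := u.2

/-- `f ∘ π|_U` as an element of `E.Fn 𝕜`. -/
def elF {E : Sh n M} {U : Set E.Total} {f : Cc n M 𝕜} (h : IsEl E U f) : E.Fn 𝕜 :=
  ⟨el E U f, h.el_mem_CcSec⟩

@[simp] theorem elF_sec {E : Sh n M} {U : Set E.Total} {f : Cc n M 𝕜} (h : IsEl E U f) :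
    (elF h).sec = el E U f := rfl

theorem Sh.Fn.induction {E : Sh n M} {p : E.Fn 𝕜 → Prop} (u : E.Fn 𝕜) (h0 : p 0)
    (hel : ∀ (U : Set E.Total) (f : Cc n M 𝕜) (h : IsEl E U f), p (elF h))
    (hadd : ∀ u v, p u → p v → p (u + v)) : p u := by
  have key : ∀ v ∈ CcSec n E.Total 𝕜, ∃ hv : v ∈ CcSec n E.Total 𝕜, p ⟨v, hv⟩ := by
    intro v hv
    rw [CcSec_eq, ← AddSubgroup.mem_toAddSubmonoid, AddSubgroup.closure_toAddSubmonoid] at hv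
    induction hv using AddSubmonoid.closure_induction with
    | mem v hv =>
      rcases hv with ⟨U, f, h, rfl⟩ | ⟨U, f, h, hv⟩
      · exact ⟨_, hel U f h⟩
      · have e : v = el E U (-f) := by rw [el_neg, ← hv, neg_neg]
        subst e
        exact ⟨_, hel U (-f) h.neg⟩
    | zero => exact ⟨zero_mem _, h0⟩
    | add v w _ _ hv hw =>
      obtain ⟨hv, hpv⟩ := hv
      obtain ⟨hw, hpw⟩ := hw
      exact ⟨add_mem hv hw, hadd _ _ hpv hpw⟩
  exact (key u.1 u.2).2

/-- The section of germs `p u`, `(p u)_y = π^*_y(p_{π(y)}) u_y`. -/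
def smulSec (E : Sh n M) (p : Cc n M 𝕜) (u : ∀ y : E.Total, Germ (𝓝 y) 𝕜) :
    ∀ y : E.Total, Germ (𝓝 y) 𝕜 :=
  fun y => ((p.1 ∘ E.proj : E.Total → 𝕜) : Germ (𝓝 y) 𝕜) * u y

theorem smulSec_add (E : Sh n M) (p : Cc n M 𝕜) (u v : ∀ y : E.Total, Germ (𝓝 y) 𝕜) :
    smulSec E p (u + v) = smulSec E p u + smulSec E p v := funext fun _ => mul_add _ _ _

theorem smulSec_el (E : Sh n M) (p : Cc n M 𝕜) (U : Set E.Total) (f : Cc n M 𝕜) :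
    smulSec E p (el E U f) = el E U (p * f) := by
  funext y
  by_cases hy : y ∈ U
  · rw [smulSec, el_mem _ hy, el_mem _ hy]; rfl
  · rw [smulSec, el_not_mem _ hy, el_not_mem _ hy, mul_zero]

theorem IsEl.mul {E : Sh n M} {U : Set E.Total} {f : Cc n M 𝕜} (h : IsEl E U f)
    (p : Cc n M 𝕜) : IsEl E U (p * f) := by
  refine ⟨h.isOpen, h.injOn, (closure_mono fun y hy => ?_).trans h.supp⟩
  simp only [Function.mem_support, Cc.mul_apply] at hy
  exact right_ne_zero_of_mul hy

theorem smulSec_mem (E : Sh n M) (p : Cc n M 𝕜) (u : E.Fn 𝕜) :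
    smulSec E p u.sec ∈ CcSec n E.Total 𝕜 := by
  induction u using Sh.Fn.induction with
  | h0 =>
    have := smulSec_add E p 0 0
    rw [map_zero]
    simp only [add_zero, left_eq_add] at this
    rw [this]; exact zero_mem _
  | hel U f h => rw [elF_sec, smulSec_el]; exact (h.mul p).el_mem_CcSec
  | hadd u v hu hv => rw [map_add, smulSec_add]; exact add_mem hu hv

/-- The module structure of `C_c^∞(E)` over `C_c^∞(M)`. -/
instance (E : Sh n M) : NUModule (Cc n M 𝕜) (E.Fn 𝕜) where
  smul p u := ⟨smulSec E p u.sec, smulSec_mem E p u⟩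
  smul_add' p u v := Sh.Fn.ext (smulSec_add E p u.sec v.sec)
  add_smul' p q u := Sh.Fn.ext (funext fun y => add_mul
    ((p.1 ∘ E.proj : E.Total → 𝕜) : Germ (𝓝 y) 𝕜) ((q.1 ∘ E.proj : E.Total → 𝕜) : Germ (𝓝 y) 𝕜)
    (u.sec y))
  mul_smul' p q u := Sh.Fn.ext (funext fun y => mul_assoc
    ((p.1 ∘ E.proj : E.Total → 𝕜) : Germ (𝓝 y) 𝕜) ((q.1 ∘ E.proj : E.Total → 𝕜) : Germ (𝓝 y) 𝕜)
    (u.sec y))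

theorem Sh.Fn.smul_sec {E : Sh n M} (p : Cc n M 𝕜) (u : E.Fn 𝕜) :
    (p • u).sec = smulSec E p u.sec := rfl

theorem smul_elF {E : Sh n M} {U : Set E.Total} {f : Cc n M 𝕜} (h : IsEl E U f)
    (p : Cc n M 𝕜) : p • elF h = elF (h.mul p) := Sh.Fn.ext (smulSec_el E p U f)

theorem elF_congr {E : Sh n M} {U V : Set E.Total} {f g : Cc n M 𝕜} (h : IsEl E U f)
    (h' : IsEl E V g) (hU : U = V) (hf : f = g) : elF h = elF h' := by
  subst hU hf; rfl


/-! ### Pushforward along morphisms, and the counit -/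

theorem Sh.Fn.finite_fibre {E : Sh n M} (u : E.Fn 𝕜) (x : M) :
    {y | E.proj y = x ∧ u.sec y ≠ 0}.Finite := by
  induction u using Sh.Fn.induction with
  | h0 => simp
  | hel U f h =>
    refine Set.Subsingleton.finite ?_
    rintro y ⟨hy, hy'⟩ z ⟨hz, hz'⟩
    have h1 : y ∈ U := by
      by_contra hc
      exact hy' (el_not_mem f hc)
    have h2 : z ∈ U := by
      by_contra hc
      exact hz' (el_not_mem f hc)
    exact h.injOn h1 h2 (hy.trans hz.symm)
  | hadd u v hu hv =>
    refine (hu.union hv).subset ?_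
    rintro y ⟨hy, hy'⟩
    by_contra hc
    simp only [Set.mem_union, Set.mem_ofPred_eq, hy, true_and, not_or, not_not] at hc
    apply hy'
    rw [map_add, Pi.add_apply, hc.1, hc.2, add_zero]

section Push

variable {E : Sh n M} {Y : Type*} [TopologicalSpace Y] {φ : E.Total → Y}

theorem push_finite (hφ : IsLocalHomeomorph φ) (hfib : ∀ y y', φ y = φ y' → E.proj y = E.proj y')
    (u : E.Fn 𝕜) (z : Y) :
    (Function.support fun y : {y : E.Total // φ y = z} => pushGerm hφ y.2 (u.sec y.1)).Finite := by
  by_cases hz : ∃ y₀, φ y₀ = z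
  · obtain ⟨y₀, rfl⟩ := hz
    refine Set.Finite.of_finite_image (f := Subtype.val) ?_ Subtype.val_injective.injOn
    refine (u.finite_fibre (E.proj y₀)).subset ?_
    rintro _ ⟨y, hy, rfl⟩
    refine ⟨hfib _ _ y.2, fun h => hy ?_⟩
    simp only [h]
    exact pushGerm_zero hφ y.2
  · refine Set.Finite.subset Set.finite_empty ?_
    rintro ⟨y, hy⟩ -
    exact hz ⟨y, hy⟩

theorem pushSec_add (hφ : IsLocalHomeomorph φ)
    (hfib : ∀ y y', φ y = φ y' → E.proj y = E.proj y') (u v : E.Fn 𝕜) :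
    pushSec hφ (u + v).sec = pushSec hφ u.sec + pushSec hφ v.sec := by
  funext z
  rw [Pi.add_apply, pushSec, pushSec, pushSec,
    ← finsum_add_distrib (push_finite hφ hfib u z) (push_finite hφ hfib v z)]
  refine finsum_congr fun y => ?_
  rw [map_add, Pi.add_apply, pushGerm_add]

theorem pushSec_zero (hφ : IsLocalHomeomorph φ) :
    pushSec hφ (0 : ∀ y : E.Total, Germ (𝓝 y) 𝕜) = 0 := by
  funext z
  exact (finsum_congr fun y => pushGerm_zero hφ y.2).trans finsum_zero

theorem pushSec_el_mem (hφ : IsLocalHomeomorph φ) {U : Set E.Total} (hinj : Set.InjOn φ U)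
    (f : Cc n M 𝕜) {y : E.Total} (hy : y ∈ U) {z : Y} (hz : φ y = z) :
    pushSec hφ (el E U f) z =
      pushGerm hφ hz ((f.1 ∘ E.proj : E.Total → 𝕜) : Germ (𝓝 y) 𝕜) := by
  rw [pushSec, finsum_eq_single _ (⟨y, hz⟩ : {y : E.Total // φ y = z}), el_mem f hy]
  rintro ⟨y', hy'⟩ hne
  have : y' ∉ U := fun hc => hne (Subtype.ext (hinj hc hy (hy'.trans hz.symm)))
  simp only [el_not_mem f this]
  exact pushGerm_zero hφ hy'

theorem pushSec_el_not_mem (hφ : IsLocalHomeomorph φ) {U : Set E.Total}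
    (f : Cc n M 𝕜) {z : Y} (hz : ∀ y ∈ U, φ y ≠ z) :
    pushSec hφ (el E U f) z = 0 := by
  rw [pushSec, finsum_eq_zero_of_forall_eq_zero]
  rintro ⟨y', hy'⟩
  have : y' ∉ U := fun hc => hz _ hc hy'
  simp only [el_not_mem f this]
  exact pushGerm_zero hφ hy'

end Push

theorem Cc.germ_eq_zero {f : Cc n M 𝕜} {x : M} (hx : x ∉ tsupport f.1) :
    (f.1 : Germ (𝓝 x) 𝕜) = 0 := Quotient.sound (Cc.eventually_zero f hx)

theorem IsEl.pushSec_proj {E : Sh n M} {U : Set E.Total} {f : Cc n M 𝕜} (h : IsEl E U f) :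
    pushSec E.isLocalHomeomorph (el E U f) = fun x => (f.1 : Germ (𝓝 x) 𝕜) := by
  funext x
  by_cases hx : ∃ y ∈ U, E.proj y = x
  · obtain ⟨y, hy, hyx⟩ := hx
    rw [pushSec_el_mem _ h.injOn f hy hyx, pushGerm_comp]
  · push Not at hx
    rw [pushSec_el_not_mem _ f hx, Cc.germ_eq_zero]
    intro hc
    obtain ⟨y, hy, rfl⟩ := h.supp hc
    exact hx y hy rfl

theorem IsEl.image {E F : Sh n M} (φ : Sh.Hom E F) {U : Set E.Total} {f : Cc n M 𝕜}
    (h : IsEl E U f) : IsEl F (φ.toFun '' U) f := by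
  refine ⟨φ.isLocalHomeomorph.isOpenMap U h.isOpen, ?_, fun x hx => ?_⟩
  · rintro _ ⟨y, hy, rfl⟩ _ ⟨z, hz, rfl⟩ hyz
    rw [φ.proj_toFun, φ.proj_toFun] at hyz
    rw [h.injOn hy hz hyz]
  · obtain ⟨y, hy, rfl⟩ := h.supp hx
    exact ⟨_, ⟨y, hy, rfl⟩, φ.proj_toFun y⟩

theorem Sh.Hom.fib {E F : Sh n M} (φ : Sh.Hom E F) (y y' : E.Total)
    (h : φ.toFun y = φ.toFun y') : E.proj y = E.proj y' := by
  rw [← φ.proj_toFun, h, φ.proj_toFun]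

theorem IsEl.pushSec_hom {E F : Sh n M} (φ : Sh.Hom E F) {U : Set E.Total} {f : Cc n M 𝕜}
    (h : IsEl E U f) :
    pushSec φ.isLocalHomeomorph (el E U f) = el F (φ.toFun '' U) f := by
  funext z
  by_cases hz : ∃ y ∈ U, φ.toFun y = z
  · obtain ⟨y, hy, rfl⟩ := hz
    rw [pushSec_el_mem _ (fun a ha b hb hab => h.injOn ha hb (φ.fib a b hab)) f hy rfl,
      el_mem f (Set.mem_image_of_mem _ hy), ← pushGerm_comp φ.isLocalHomeomorph rfl]
    congr 2
    funext w
    simp [φ.proj_toFun]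
  · push Not at hz
    rw [pushSec_el_not_mem _ f hz, el_not_mem]
    rintro ⟨y, hy, rfl⟩
    exact hz y hy rfl

theorem pushSec_mem {E F : Sh n M} (φ : Sh.Hom E F) (u : E.Fn 𝕜) :
    pushSec φ.isLocalHomeomorph u.sec ∈ CcSec n F.Total 𝕜 := by
  induction u using Sh.Fn.induction with
  | h0 => rw [map_zero, pushSec_zero]; exact zero_mem _
  | hel U f h => rw [elF_sec, h.pushSec_hom]; exact (h.image φ).el_mem_CcSec
  | hadd u v hu hv => rw [pushSec_add _ φ.fib]; exact add_mem hu hv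

/-- The pushforward as an additive map. -/
def Sh.Hom.pushHom {E F : Sh n M} (φ : Sh.Hom E F) : E.Fn 𝕜 →+ F.Fn 𝕜 :=
  AddMonoidHom.mk' (fun u => ⟨pushSec φ.isLocalHomeomorph u.sec, pushSec_mem φ u⟩)
    (fun u v => Sh.Fn.ext (pushSec_add _ φ.fib u v))

theorem Sh.Hom.pushHom_elF {E F : Sh n M} (φ : Sh.Hom E F) {U : Set E.Total} {f : Cc n M 𝕜}
    (h : IsEl E U f) : φ.pushHom (elF h) = elF (h.image φ) := Sh.Fn.ext (h.pushSec_hom φ)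

variable (𝕜) in
/-- The pushforward `φ_+ : C_c^∞(E) → C_c^∞(F)` of a morphism `φ : E → F` of sheaves. -/
def Sh.Hom.push {E F : Sh n M} (φ : Sh.Hom E F) : NULin (Cc n M 𝕜) (E.Fn 𝕜) (F.Fn 𝕜) where
  toAddMonoidHom := φ.pushHom
  map_smul' p u := by
    change φ.pushHom (p • u) = p • φ.pushHom u
    induction u using Sh.Fn.induction with
    | h0 => simp [nu_smul_zero]
    | hel U f h => rw [smul_elF, φ.pushHom_elF, φ.pushHom_elF, smul_elF]
    | hadd u v hu hv => simp [nu_smul_add, hu, hv]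

theorem Sh.Hom.push_elF {E F : Sh n M} (φ : Sh.Hom E F) {U : Set E.Total} {f : Cc n M 𝕜}
    (h : IsEl E U f) : φ.push 𝕜 (elF h) = elF (h.image φ) := φ.pushHom_elF h

theorem value_pushSec_mem {E : Sh n M} (u : E.Fn 𝕜) :
    (fun x => (pushSec E.isLocalHomeomorph u.sec x).value) ∈ Cc n M 𝕜 := by
  induction u using Sh.Fn.induction with
  | h0 => rw [map_zero, pushSec_zero]; exact zero_mem _
  | hel U f h => rw [elF_sec, h.pushSec_proj]; exact f.2
  | hadd u v hu hv =>
    rw [pushSec_add _ fun _ _ h => h]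
    convert add_mem hu hv using 1
    funext x
    exact map_add Germ.valueRingHom _ _

/-- The counit as an additive map. -/
def Sh.counitHom (E : Sh n M) : E.Fn 𝕜 →+ Cc n M 𝕜 :=
  AddMonoidHom.mk'
    (fun u => ⟨fun x => (pushSec E.isLocalHomeomorph u.sec x).value, value_pushSec_mem u⟩)
    (fun u v => Subtype.ext (by
      funext x
      change (pushSec E.isLocalHomeomorph (u + v).sec x).value = _
      rw [pushSec_add _ fun _ _ h => h]
      exact map_add Germ.valueRingHom _ _))

theorem Sh.counitHom_elF (E : Sh n M) {U : Set E.Total} {f : Cc n M 𝕜}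
    (h : IsEl E U f) : E.counitHom (elF h) = f := by
  refine Subtype.ext ?_
  change (fun x => (pushSec E.isLocalHomeomorph (el E U f) x).value) = f.1
  rw [h.pushSec_proj]
  rfl

variable (𝕜) in
/-- The counit `ε = π_+ : C_c^∞(E) → C_c^∞(M)`: the function whose value at `x` is the value at `x`
of the germ `π_+(u)_x`. -/
def Sh.counit (E : Sh n M) : NULin (Cc n M 𝕜) (E.Fn 𝕜) (Cc n M 𝕜) where
  toAddMonoidHom := E.counitHom
  map_smul' p u := by
    change E.counitHom (p • u) = p • E.counitHom u
    induction u using Sh.Fn.induction with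
    | h0 => simp [nu_smul_zero]
    | hel U f h => rw [smul_elF, E.counitHom_elF, E.counitHom_elF]; rfl
    | hadd u v hu hv => rw [nu_smul_add, map_add, hu, hv, map_add, nu_smul_add]

theorem Sh.counit_elF (E : Sh n M) {U : Set E.Total} {f : Cc n M 𝕜}
    (h : IsEl E U f) : E.counit 𝕜 (elF h) = f := E.counitHom_elF h

end SheafFunctions


noncomputable section Stalks

variable {n : ℕ} {M : Type u} [TopologicalSpace M] [ChartedSpace (EuclideanSpace ℝ (Fin n)) M]
  [IsManifold (𝓡 n) ∞ M] [T2Space M] {𝕜 : Type} [RCLike 𝕜]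
  {C : Type*} [AddCommGroup C] [NUModule (Cc n M 𝕜) C]
  {D : Type*} [AddCommGroup D] [NUModule (Cc n M 𝕜) D]

/-- The submodule `N_x(C)` of the elements annihilated by some function with germ `1` at `x`. -/
def stalkKer (x : M) (C : Type*) [AddCommGroup C] [NUModule (Cc n M 𝕜) C] : AddSubgroup C where
  carrier := {c | ∃ f : Cc n M 𝕜, (∀ᶠ y in 𝓝 x, f.1 y = 1) ∧ f • c = 0}
  zero_mem' := by
    obtain ⟨f, -, hf⟩ := exists_bump (n := n) 𝕜 x Filter.univ_mem
    exact ⟨f, hf, nu_smul_zero f⟩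
  add_mem' := by
    rintro c d ⟨f, hf, hc⟩ ⟨g, hg, hd⟩
    refine ⟨f * g, ?_, ?_⟩
    · filter_upwards [hf, hg] with y h1 h2
      simp [h1, h2]
    · rw [nu_smul_add, nu_mul_smul, nu_mul_smul, hd, nu_smul_comm, hc, nu_smul_zero,
        nu_smul_zero, add_zero]
  neg_mem' := by
    rintro c ⟨f, hf, hc⟩
    exact ⟨f, hf, by rw [nu_smul_neg, hc, neg_zero]⟩

theorem mem_stalkKer {x : M} {c : C} : c ∈ stalkKer (𝕜 := 𝕜) (n := n) x C ↔
    ∃ f : Cc n M 𝕜, (∀ᶠ y in 𝓝 x, f.1 y = 1) ∧ f • c = 0 := Iff.rfl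

variable (n 𝕜) in
/-- The local module `C_x = C / N_x(C)`. -/
def Stalk (x : M) (C : Type*) [AddCommGroup C] [NUModule (Cc n M 𝕜) C] : Type _ :=
  C ⧸ stalkKer (𝕜 := 𝕜) (n := n) x C

instance (x : M) : AddCommGroup (Stalk n 𝕜 x C) :=
  inferInstanceAs (AddCommGroup (C ⧸ stalkKer (𝕜 := 𝕜) (n := n) x C))

variable (n 𝕜) in
/-- The projection `C → C_x`, `c ↦ c_x`. -/
def stalkHom (x : M) : C →+ Stalk n 𝕜 x C := QuotientAddGroup.mk' (stalkKer x C)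

theorem stalkHom_surjective (x : M) : Function.Surjective (stalkHom n 𝕜 x (C := C)) :=
  QuotientAddGroup.mk'_surjective _

theorem stalkHom_eq_zero {x : M} {c : C} : stalkHom n 𝕜 x c = 0 ↔
    ∃ f : Cc n M 𝕜, (∀ᶠ y in 𝓝 x, f.1 y = 1) ∧ f • c = 0 :=
  (QuotientAddGroup.eq_zero_iff _).trans mem_stalkKer

theorem stalkHom_eq {x : M} {c d : C} : stalkHom n 𝕜 x c = stalkHom n 𝕜 x d ↔
    ∃ f : Cc n M 𝕜, (∀ᶠ y in 𝓝 x, f.1 y = 1) ∧ f • c = f • d := by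
  rw [← sub_eq_zero, ← map_sub, stalkHom_eq_zero]
  simp only [nu_smul_sub, sub_eq_zero]

/-- The additive map out of `C_x` induced by an additive map that vanishes on `N_x(C)`. -/
def stalkLift {B : Type*} [AddCommGroup B] {x : M} (b : C →+ B)
    (hb : ∀ (f : Cc n M 𝕜) (c : C), (∀ᶠ y in 𝓝 x, f.1 y = 1) → f • c = 0 → b c = 0) :
    Stalk n 𝕜 x C →+ B :=
  QuotientAddGroup.lift (stalkKer x C) b (fun c ⟨f, hf, hc⟩ => hb f c hf hc)

@[simp] theorem stalkLift_stalkHom {B : Type*} [AddCommGroup B] {x : M} (b : C →+ B)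
    (hb : ∀ (f : Cc n M 𝕜) (c : C), (∀ᶠ y in 𝓝 x, f.1 y = 1) → f • c = 0 → b c = 0) (c : C) :
    stalkLift b hb (stalkHom n 𝕜 x c) = b c := rfl

/-- Multiplication by `r` on `C_x`. -/
def stalkSmul (x : M) (r : Cc n M 𝕜) : Stalk n 𝕜 x C →+ Stalk n 𝕜 x C :=
  stalkLift ((stalkHom n 𝕜 x).comp (smulHom r)) (fun f c hf hc => by
    refine stalkHom_eq_zero.2 ⟨f, hf, ?_⟩
    rw [smulHom_apply, nu_smul_comm, hc, nu_smul_zero])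

/-- The `C_c^∞(M)`-module structure of `C_x`. -/
instance (x : M) : NUModule (Cc n M 𝕜) (Stalk n 𝕜 x C) where
  smul r t := stalkSmul x r t
  smul_add' r s t := map_add _ _ _
  add_smul' r s t := by
    obtain ⟨c, rfl⟩ := stalkHom_surjective x t
    exact (congrArg (stalkHom n 𝕜 x) (nu_add_smul r s c)).trans (map_add _ _ _)
  mul_smul' r s t := by
    obtain ⟨c, rfl⟩ := stalkHom_surjective x t
    exact congrArg (stalkHom n 𝕜 x) (nu_mul_smul r s c)

theorem smul_stalkHom (x : M) (r : Cc n M 𝕜) (c : C) :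
    r • stalkHom n 𝕜 x c = stalkHom n 𝕜 x (r • c) := rfl

variable (n 𝕜) in
/-- The projection `C → C_x` as a linear map. -/
def stalkMk (x : M) (C : Type*) [AddCommGroup C] [NUModule (Cc n M 𝕜) C] :
    NULin (Cc n M 𝕜) C (Stalk n 𝕜 x C) where
  toAddMonoidHom := stalkHom n 𝕜 x
  map_smul' _ _ := rfl

@[simp] theorem stalkMk_apply (x : M) (c : C) : stalkMk n 𝕜 x C c = stalkHom n 𝕜 x c := rfl

theorem stalk_smul_congr {x : M} {f g : Cc n M 𝕜} (h : ∀ᶠ y in 𝓝 x, f.1 y = g.1 y)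
    (t : Stalk n 𝕜 x C) : f • t = g • t := by
  obtain ⟨c, rfl⟩ := stalkHom_surjective x t
  rw [smul_stalkHom, smul_stalkHom, stalkHom_eq]
  obtain ⟨k, hk, hk1⟩ := exists_bump (n := n) 𝕜 x h
  refine ⟨k, hk1, ?_⟩
  rw [← nu_mul_smul, ← nu_mul_smul]
  congr 1
  ext y
  by_cases hy : y ∈ tsupport k.1
  · have : f.1 y = g.1 y := hk hy
    simp [this]
  · simp [image_eq_zero_of_notMem_tsupport hy]

theorem stalk_smul_one {x : M} {f : Cc n M 𝕜} (h : ∀ᶠ y in 𝓝 x, f.1 y = 1)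
    (t : Stalk n 𝕜 x C) : f • t = t := by
  obtain ⟨c, rfl⟩ := stalkHom_surjective x t
  rw [smul_stalkHom, stalkHom_eq]
  obtain ⟨k, hk, hk1⟩ := exists_bump (n := n) 𝕜 x h
  refine ⟨k, hk1, ?_⟩
  rw [← nu_mul_smul]
  congr 1
  ext y
  by_cases hy : y ∈ tsupport k.1
  · have : f.1 y = 1 := hk hy
    simp [this]
  · simp [image_eq_zero_of_notMem_tsupport hy]

/-- An element with a local identity vanishes if all its germs do. -/
theorem eq_zero_of_stalk {c : C} (r : Cc n M 𝕜) (hr : r • c = c)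
    (h : ∀ x : M, stalkHom n 𝕜 x c = 0) : c = 0 := by
  have key : ∃ f : Cc n M 𝕜, (∀ y ∈ tsupport r.1, f.1 y = 1) ∧ f • c = 0 := by
    refine (Cc.compact r).isCompact.induction_on
      (p := fun K => ∃ f : Cc n M 𝕜, (∀ y ∈ K, f.1 y = 1) ∧ f • c = 0) ?_ ?_ ?_ ?_
    · exact ⟨0, by simp, nu_zero_smul c⟩
    · rintro s t hst ⟨f, h1, h2⟩
      exact ⟨f, fun y hy => h1 y (hst hy), h2⟩
    · rintro s t ⟨f, h1, h2⟩ ⟨g, h3, h4⟩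
      refine ⟨f + g - f * g, ?_, ?_⟩
      · rintro y (hy | hy)
        · simp [h1 y hy]
        · simp [h3 y hy]
      · rw [nu_sub_smul, nu_add_smul, nu_mul_smul, h2, h4, nu_smul_zero]
        simp
    · intro x _
      obtain ⟨f, hf, hfc⟩ := stalkHom_eq_zero.1 (h x)
      exact ⟨_, mem_nhdsWithin_of_mem_nhds hf, f, fun y hy => hy, hfc⟩
  obtain ⟨f, hf, hfc⟩ := key
  have : r * f = r := by
    ext y
    by_cases hy : y ∈ tsupport r.1
    · simp [hf y hy]
    · simp [image_eq_zero_of_notMem_tsupport hy]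
  rw [← hr, ← this, nu_mul_smul, hfc, nu_smul_zero]

theorem stalk_tmul_congr {x : M} {c c' : C} {d d' : D}
    (hc : stalkHom n 𝕜 x c = stalkHom n 𝕜 x c') (hd : stalkHom n 𝕜 x d = stalkHom n 𝕜 x d') :
    stalkHom n 𝕜 x (BTensor.tmul (Cc n M 𝕜) c d) =
      stalkHom n 𝕜 x (BTensor.tmul (Cc n M 𝕜) c' d') := by
  obtain ⟨f, hf, hfc⟩ := stalkHom_eq.1 hc
  obtain ⟨g, hg, hgd⟩ := stalkHom_eq.1 hd
  refine stalkHom_eq.2 ⟨f * g, ?_, ?_⟩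
  · filter_upwards [hf, hg] with y h1 h2
    simp [h1, h2]
  · simp only [nu_mul_smul, BTensor.smul_def_tmul]
    rw [nu_smul_comm, hfc, BTensor.smul_tmul, hgd, ← BTensor.smul_tmul, nu_smul_comm]

end Stalks


noncomputable section Comultiplication

variable {n : ℕ} {M : Type u} [TopologicalSpace M] [ChartedSpace (EuclideanSpace ℝ (Fin n)) M]
  [IsManifold (𝓡 n) ∞ M] {𝕜 : Type} [RCLike 𝕜]

/-- The first projection `E ×_M F → E`. -/
def Sh.fst (E F : Sh n M) : Sh.Hom (E.prod F) E :=
  Sh.homOfContinuous (E := E.prod F) (fun p : Sh.FibreProd E F => p.1.1)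
    (continuous_fst.comp continuous_subtype_val) (fun _ => rfl)

/-- The second projection `E ×_M F → F`. -/
def Sh.snd (E F : Sh n M) : Sh.Hom (E.prod F) F :=
  Sh.homOfContinuous (E := E.prod F) (fun p : Sh.FibreProd E F => p.1.2)
    (continuous_snd.comp continuous_subtype_val) (fun p => p.2.symm)

/-- The pullback `φ^*_y` of germs along a continuous map. -/
def pullGerm {X Y : Type*} [TopologicalSpace X] [TopologicalSpace Y] {φ : X → Y}
    (hφ : Continuous φ) (y : X) (g : Germ (𝓝 (φ y)) 𝕜) : Germ (𝓝 y) 𝕜 :=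
  g.compTendsto φ hφ.continuousAt

theorem pullGerm_add {X Y : Type*} [TopologicalSpace X] [TopologicalSpace Y] {φ : X → Y}
    (hφ : Continuous φ) (y : X) (g g' : Germ (𝓝 (φ y)) 𝕜) :
    pullGerm hφ y (g + g') = pullGerm hφ y g + pullGerm hφ y g' := by
  induction g using Germ.inductionOn with | _ g =>
  induction g' using Germ.inductionOn with | _ g' =>
  rfl

/-- The section of germs `(pr₁^* u) (pr₂^* v)` on `E ×_M F`. -/
def omegaSec {E F : Sh n M} (u : ∀ y : E.Total, Germ (𝓝 y) 𝕜) (v : ∀ z : F.Total, Germ (𝓝 z) 𝕜) :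
    ∀ p : (E.prod F).Total, Germ (𝓝 p) 𝕜 :=
  fun p => pullGerm (Sh.fst E F).smooth.continuous p (u ((Sh.fst E F).toFun p)) *
    pullGerm (Sh.snd E F).smooth.continuous p (v ((Sh.snd E F).toFun p))

theorem omegaSec_add_left {E F : Sh n M} (u u' : ∀ y : E.Total, Germ (𝓝 y) 𝕜)
    (v : ∀ z : F.Total, Germ (𝓝 z) 𝕜) :
    omegaSec (u + u') v = omegaSec u v + omegaSec u' v := by
  funext p
  simp only [omegaSec, Pi.add_apply, pullGerm_add, add_mul]

theorem omegaSec_add_right {E F : Sh n M} (u : ∀ y : E.Total, Germ (𝓝 y) 𝕜)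
    (v v' : ∀ z : F.Total, Germ (𝓝 z) 𝕜) :
    omegaSec u (v + v') = omegaSec u v + omegaSec u v' := by
  funext p
  simp only [omegaSec, Pi.add_apply, pullGerm_add, mul_add]

/-- The elementary subset `U ×_M V`. -/
def prodSet (E F : Sh n M) (U : Set E.Total) (V : Set F.Total) : Set (E.prod F).Total :=
  {p | (Sh.fst E F).toFun p ∈ U ∧ (Sh.snd E F).toFun p ∈ V}

theorem proj_eq_fst {E F : Sh n M} (p : (E.prod F).Total) :
    (E.prod F).proj p = E.proj ((Sh.fst E F).toFun p) := ((Sh.fst E F).proj_toFun p).symm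

theorem proj_eq_snd {E F : Sh n M} (p : (E.prod F).Total) :
    (E.prod F).proj p = F.proj ((Sh.snd E F).toFun p) := ((Sh.snd E F).proj_toFun p).symm

theorem prod_ext {E F : Sh n M} {p q : (E.prod F).Total}
    (h1 : (Sh.fst E F).toFun p = (Sh.fst E F).toFun q)
    (h2 : (Sh.snd E F).toFun p = (Sh.snd E F).toFun q) : p = q :=
  Subtype.ext (Prod.ext h1 h2)

theorem exists_prod {E F : Sh n M} {y : E.Total} {z : F.Total} (h : E.proj y = F.proj z) :
    ∃ p : (E.prod F).Total, (Sh.fst E F).toFun p = y ∧ (Sh.snd E F).toFun p = z :=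
  ⟨(⟨(y, z), h⟩ : Sh.FibreProd E F), rfl, rfl⟩

theorem omegaSec_el {E F : Sh n M} (U : Set E.Total) (V : Set F.Total) (f g : Cc n M 𝕜) :
    omegaSec (el E U f) (el F V g) = el (E.prod F) (prodSet E F U V) (f * g) := by
  funext p
  by_cases h1 : (Sh.fst E F).toFun p ∈ U
  · by_cases h2 : (Sh.snd E F).toFun p ∈ V
    · rw [omegaSec, el_mem _ h1, el_mem _ h2, el_mem _ (show p ∈ prodSet E F U V from ⟨h1, h2⟩)]
      refine Quotient.sound (Eventually.of_forall fun q => ?_)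
      change f.1 (E.proj ((Sh.fst E F).toFun q)) * g.1 (F.proj ((Sh.snd E F).toFun q)) =
        f.1 ((E.prod F).proj q) * g.1 ((E.prod F).proj q)
      rw [← proj_eq_fst, ← proj_eq_snd]
    · rw [omegaSec, el_not_mem _ h2, el_not_mem _ (show p ∉ prodSet E F U V from fun h => h2 h.2)]
      exact mul_zero _
  · rw [omegaSec, el_not_mem _ h1, el_not_mem _ (show p ∉ prodSet E F U V from fun h => h1 h.1)]
    exact zero_mul _

theorem IsEl.prod [T2Space M] {E F : Sh n M} {U : Set E.Total} {V : Set F.Total} {f g : Cc n M 𝕜}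
    (hf : IsEl E U f) (hg : IsEl F V g) : IsEl (E.prod F) (prodSet E F U V) (f * g) := by
  refine ⟨(hf.isOpen.preimage (Sh.fst E F).smooth.continuous).inter
    (hg.isOpen.preimage (Sh.snd E F).smooth.continuous), ?_, ?_⟩
  · rintro p ⟨hp1, hp2⟩ q ⟨hq1, hq2⟩ hpq
    refine prod_ext (hf.injOn hp1 hq1 ?_) (hg.injOn hp2 hq2 ?_)
    · rw [← proj_eq_fst, ← proj_eq_fst, hpq]
    · rw [← proj_eq_snd, ← proj_eq_snd, hpq]
  · intro x hx
    have h1 : x ∈ tsupport f.1 := by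
      refine closure_mono (fun y hy => ?_) hx
      simp only [Function.mem_support, Cc.mul_apply] at hy
      exact left_ne_zero_of_mul hy
    have h2 : x ∈ tsupport g.1 := by
      refine closure_mono (fun y hy => ?_) hx
      simp only [Function.mem_support, Cc.mul_apply] at hy
      exact right_ne_zero_of_mul hy
    obtain ⟨y, hy, rfl⟩ := hf.supp h1
    obtain ⟨z, hz, hyz⟩ := hg.supp h2
    obtain ⟨p, rfl, rfl⟩ := exists_prod hyz.symm
    exact ⟨p, ⟨hy, hz⟩, proj_eq_fst p⟩

variable [T2Space M]

theorem omegaSec_mem {E F : Sh n M} (u : E.Fn 𝕜) (v : F.Fn 𝕜) :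
    omegaSec u.sec v.sec ∈ CcSec n (E.prod F).Total 𝕜 := by
  induction u using Sh.Fn.induction with
  | h0 =>
    have := omegaSec_add_left 0 0 v.sec (E := E)
    simp only [add_zero, left_eq_add] at this
    rw [map_zero, this]; exact zero_mem _
  | hel U f h =>
    induction v using Sh.Fn.induction with
    | h0 =>
      have := omegaSec_add_right (elF h).sec 0 0 (F := F)
      simp only [add_zero, left_eq_add] at this
      rw [map_zero, this]; exact zero_mem _
    | hel V g h' => rw [elF_sec, elF_sec, omegaSec_el]; exact (h.prod h').el_mem_CcSec
    | hadd u v hu hv => rw [map_add, omegaSec_add_right]; exact add_mem hu hv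
  | hadd u v hu hv => rw [map_add, omegaSec_add_left]; exact add_mem hu hv

/-- The biadditive map underlying `Ω`. -/
def omegaBi (E F : Sh n M) : E.Fn 𝕜 →+ F.Fn 𝕜 →+ (E.prod F).Fn 𝕜 :=
  AddMonoidHom.mk' (fun u => AddMonoidHom.mk' (fun v => ⟨omegaSec u.sec v.sec, omegaSec_mem u v⟩)
      (fun v v' => Sh.Fn.ext (omegaSec_add_right u.sec v.sec v'.sec)))
    (fun u u' => by
      ext v
      exact Sh.Fn.ext (omegaSec_add_left u.sec u'.sec v.sec))

theorem omegaBi_elF {E F : Sh n M} {U : Set E.Total} {V : Set F.Total} {f g : Cc n M 𝕜}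
    (hf : IsEl E U f) (hg : IsEl F V g) : omegaBi E F (elF hf) (elF hg) = elF (hf.prod hg) :=
  Sh.Fn.ext (omegaSec_el U V f g)

theorem omegaBi_smul_left {E F : Sh n M} (r : Cc n M 𝕜) (u : E.Fn 𝕜) (v : F.Fn 𝕜) :
    omegaBi E F (r • u) v = r • omegaBi E F u v := by
  induction u using Sh.Fn.induction with
  | h0 => simp [nu_smul_zero]
  | hel U f h =>
    induction v using Sh.Fn.induction with
    | h0 => simp [nu_smul_zero]
    | hel V g h' =>
      rw [smul_elF, omegaBi_elF, omegaBi_elF, smul_elF]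
      exact elF_congr _ _ rfl (mul_assoc _ _ _)
    | hadd u v hu hv => simp only [map_add, nu_smul_add, hu, hv]
  | hadd u u' hu hv => simp only [map_add, nu_smul_add, hu, hv, AddMonoidHom.add_apply]

theorem omegaBi_smul_right {E F : Sh n M} (r : Cc n M 𝕜) (u : E.Fn 𝕜) (v : F.Fn 𝕜) :
    omegaBi E F u (r • v) = r • omegaBi E F u v := by
  induction u using Sh.Fn.induction with
  | h0 => simp [nu_smul_zero]
  | hel U f h =>
    induction v using Sh.Fn.induction with
    | h0 => simp [nu_smul_zero]
    | hel V g h' =>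
      rw [smul_elF, omegaBi_elF, omegaBi_elF, smul_elF]
      exact elF_congr _ _ rfl (mul_left_comm _ _ _)
    | hadd u v hu hv => simp only [map_add, nu_smul_add, hu, hv]
  | hadd u u' hu hv => simp only [map_add, nu_smul_add, hu, hv, AddMonoidHom.add_apply]

/-- The additive map underlying `Ω`. -/
def omegaHom (E F : Sh n M) : BTensor (Cc n M 𝕜) (E.Fn 𝕜) (F.Fn 𝕜) →+ (E.prod F).Fn 𝕜 :=
  BTensor.lift (omegaBi E F) (fun r u v => by rw [omegaBi_smul_left, omegaBi_smul_right])

variable (𝕜) in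
/-- The natural map `Ω : C_c^∞(E) ⊗ C_c^∞(F) → C_c^∞(E ×_M F)`,
`Ω(u ⊗ v)_{(y,z)} = pr₁^*(u_y) pr₂^*(v_z)`. -/
def omega (E F : Sh n M) :
    NULin (Cc n M 𝕜) (BTensor (Cc n M 𝕜) (E.Fn 𝕜) (F.Fn 𝕜)) ((E.prod F).Fn 𝕜) where
  toAddMonoidHom := omegaHom E F
  map_smul' r t := by
    refine DFunLike.congr_fun (f := (omegaHom E F).comp (smulHom r))
      (g := (smulHom r).comp (omegaHom E F)) (BTensor.hom_ext ?_) t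
    intro u v
    exact omegaBi_smul_left r u v

theorem omega_tmul {E F : Sh n M} (u : E.Fn 𝕜) (v : F.Fn 𝕜) :
    omega 𝕜 E F (BTensor.tmul _ u v) = omegaBi E F u v := rfl

theorem omega_elF {E F : Sh n M} {U : Set E.Total} {V : Set F.Total} {f g : Cc n M 𝕜}
    (hf : IsEl E U f) (hg : IsEl F V g) :
    omega 𝕜 E F (BTensor.tmul _ (elF hf) (elF hg)) = elF (hf.prod hg) := omegaBi_elF hf hg

/-! ### Bijectivity of `Ω` -/

theorem IsEl.exists_unit {E : Sh n M} {U : Set E.Total} {f : Cc n M 𝕜} (h : IsEl E U f) :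
    ∃ η : Cc n M 𝕜, IsEl E U η ∧ η * f = f := by
  obtain ⟨η, h1, h2⟩ := exists_local_unit f (E.isLocalHomeomorph.isOpenMap U h.isOpen) h.supp
  exact ⟨η, ⟨h.isOpen, h.injOn, h1⟩, h2⟩

theorem Sh.Fn.isLocallyUnitary (E : Sh n M) : IsLocallyUnitary (Cc n M 𝕜) (E.Fn 𝕜) := by
  refine isLocallyUnitary_of_forall fun u => ?_
  induction u using Sh.Fn.induction with
  | h0 => exact ⟨0, nu_smul_zero _⟩
  | hel U f h =>
    obtain ⟨η, -, h2⟩ := h.exists_unit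
    exact ⟨η, by rw [smul_elF]; exact elF_congr _ _ rfl h2⟩
  | hadd u v hu hv =>
    obtain ⟨r, hr⟩ := hu
    obtain ⟨s, hs⟩ := hv
    refine ⟨r + s - r * s, ?_⟩
    rw [nu_smul_add, nu_sub_smul, nu_sub_smul, nu_add_smul, nu_add_smul, nu_mul_smul, nu_mul_smul,
      hs, nu_smul_comm, hr]
    abel

theorem omega_surjective (E F : Sh n M) : Function.Surjective (omega 𝕜 E F) := by
  intro w
  induction w using Sh.Fn.induction with
  | h0 => exact ⟨0, map_zero _⟩
  | hel W f h =>
    obtain ⟨η, hη, hηf⟩ := h.exists_unit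
    have e1 := h.image (Sh.fst E F)
    have e2 := hη.image (Sh.snd E F)
    refine ⟨BTensor.tmul _ (elF e1) (elF e2), ?_⟩
    rw [omega_elF]
    refine elF_congr _ _ ?_ (by rw [mul_comm, hηf])
    ext p
    refine ⟨?_, fun hp => ⟨⟨p, hp, rfl⟩, ⟨p, hp, rfl⟩⟩⟩
    rintro ⟨⟨q, hq, hq'⟩, ⟨q', hqq, hqq'⟩⟩
    have h1 : q = q' := by
      refine h.injOn hq hqq ?_
      rw [proj_eq_fst, hq', proj_eq_snd, hqq', ← proj_eq_fst, ← proj_eq_snd]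
    subst h1
    rwa [← prod_ext hq' hqq']
  | hadd u v hu hv =>
    obtain ⟨s, hs⟩ := hu
    obtain ⟨t, ht⟩ := hv
    exact ⟨s + t, by rw [map_add, hs, ht]⟩

section Theta

variable {D : Type*} [AddCommGroup D] [NUModule (Cc n M 𝕜) D]

open scoped Classical in
/-- The action of germs of smooth functions on `D_x` (zero on other germs). -/
def germAct (x : M) (g : Germ (𝓝 x) 𝕜) (t : Stalk n 𝕜 x D) : Stalk n 𝕜 x D :=
  if h : ∃ f : Cc n M 𝕜, (f.1 : Germ (𝓝 x) 𝕜) = g then h.choose • t else 0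

theorem germAct_coe (x : M) (f : Cc n M 𝕜) (t : Stalk n 𝕜 x D) :
    germAct x (f.1 : Germ (𝓝 x) 𝕜) t = f • t := by
  have h : ∃ f' : Cc n M 𝕜, (f'.1 : Germ (𝓝 x) 𝕜) = f.1 := ⟨f, rfl⟩
  rw [germAct, dif_pos h]
  exact stalk_smul_congr (Germ.coe_eq.1 h.choose_spec) t

theorem Sh.Fn.exists_germ {E : Sh n M} (u : E.Fn 𝕜) {y : E.Total} {x : M} (h : E.proj y = x) :
    ∃ f : Cc n M 𝕜, pushGerm E.isLocalHomeomorph h (u.sec y) = (f.1 : Germ (𝓝 x) 𝕜) := by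
  induction u using Sh.Fn.induction with
  | h0 => exact ⟨0, by rw [map_zero]; exact pushGerm_zero _ h⟩
  | hel U f hU =>
    by_cases hy : y ∈ U
    · exact ⟨f, by rw [elF_sec, el_mem f hy, pushGerm_comp]⟩
    · exact ⟨0, by rw [elF_sec, el_not_mem f hy]; exact pushGerm_zero _ h⟩
  | hadd u v hu hv =>
    obtain ⟨f, hf⟩ := hu
    obtain ⟨g, hg⟩ := hv
    exact ⟨f + g, by rw [map_add, Pi.add_apply, pushGerm_add, hf, hg]; rfl⟩

/-- The map `C_c^∞(E) → D_x` given by a family of elements of `D_x` indexed by the fibre of `E`. -/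
def theta {E : Sh n M} (x : M) (τ : {y : E.Total // E.proj y = x} → Stalk n 𝕜 x D) :
    E.Fn 𝕜 → Stalk n 𝕜 x D :=
  fun u => ∑ᶠ y : {y : E.Total // E.proj y = x},
    germAct x (pushGerm E.isLocalHomeomorph y.2 (u.sec y.1)) (τ y)

theorem germAct_zero (x : M) (t : Stalk n 𝕜 x D) : germAct x (0 : Germ (𝓝 x) 𝕜) t = 0 :=
  (germAct_coe x 0 t).trans (nu_zero_smul t)

theorem theta_finite {E : Sh n M} (x : M) (τ : {y : E.Total // E.proj y = x} → Stalk n 𝕜 x D)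
    (u : E.Fn 𝕜) : (Function.support fun y : {y : E.Total // E.proj y = x} =>
      germAct x (pushGerm E.isLocalHomeomorph y.2 (u.sec y.1)) (τ y)).Finite := by
  refine (push_finite E.isLocalHomeomorph (fun _ _ h => h) u x).subset fun y hy hy' => hy ?_
  simp only [hy', germAct_zero]

theorem theta_add {E : Sh n M} (x : M) (τ : {y : E.Total // E.proj y = x} → Stalk n 𝕜 x D)
    (u v : E.Fn 𝕜) : theta x τ (u + v) = theta x τ u + theta x τ v := by
  rw [theta, theta, theta, ← finsum_add_distrib (theta_finite x τ u) (theta_finite x τ v)]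
  refine finsum_congr fun y => ?_
  obtain ⟨f, hf⟩ := u.exists_germ y.2
  obtain ⟨g, hg⟩ := v.exists_germ y.2
  rw [map_add, Pi.add_apply, pushGerm_add, hf, hg, germAct_coe, germAct_coe]
  exact (germAct_coe x (f + g) _).trans (nu_add_smul f g _)

theorem theta_zero {E : Sh n M} (x : M) (τ : {y : E.Total // E.proj y = x} → Stalk n 𝕜 x D) :
    theta x τ 0 = 0 := by
  have := theta_add x τ 0 0
  simpa using this

theorem theta_elF_mem {E : Sh n M} (x : M) (τ : {y : E.Total // E.proj y = x} → Stalk n 𝕜 x D)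
    {U : Set E.Total} {f : Cc n M 𝕜} (h : IsEl E U f) (y : {y : E.Total // E.proj y = x})
    (hy : y.1 ∈ U) : theta x τ (elF h) = f • τ y := by
  rw [theta, finsum_eq_single _ y, elF_sec, el_mem f hy, pushGerm_comp, germAct_coe]
  intro z hz
  have : z.1 ∉ U := fun hc => hz (Subtype.ext (h.injOn hc hy (z.2.trans y.2.symm)))
  rw [elF_sec, el_not_mem f this]
  exact (congrArg (fun g => germAct x g (τ z)) (pushGerm_zero _ z.2)).trans (germAct_zero x _)

theorem theta_elF_not_mem {E : Sh n M} (x : M)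
    (τ : {y : E.Total // E.proj y = x} → Stalk n 𝕜 x D)
    {U : Set E.Total} {f : Cc n M 𝕜} (h : IsEl E U f) (hx : ∀ y ∈ U, E.proj y ≠ x) :
    theta x τ (elF h) = 0 := by
  rw [theta, finsum_eq_zero_of_forall_eq_zero]
  intro z
  have : z.1 ∉ U := fun hc => hx _ hc z.2
  rw [elF_sec, el_not_mem f this]
  exact (congrArg (fun g => germAct x g (τ z)) (pushGerm_zero _ z.2)).trans (germAct_zero x _)

end Theta

/-- Elementary functions agreeing near a point have the same germ. -/
theorem stalk_elF_congr {E : Sh n M} {U U' : Set E.Total} {f f' : Cc n M 𝕜} (h : IsEl E U f)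
    (h' : IsEl E U' f') {x : M} {y : E.Total} (hy : y ∈ U) (hy' : y ∈ U') (hyx : E.proj y = x)
    (hff : ∀ᶠ z in 𝓝 x, f.1 z = f'.1 z) :
    stalkHom n 𝕜 x (elF h) = stalkHom n 𝕜 x (elF h') := by
  have hW : E.proj '' (U ∩ U') ∈ 𝓝 x :=
    (E.isLocalHomeomorph.isOpenMap _ (h.isOpen.inter h'.isOpen)).mem_nhds ⟨y, ⟨hy, hy'⟩, hyx⟩
  obtain ⟨k, hk, hk1⟩ := exists_bump (n := n) 𝕜 x (Filter.inter_mem hW hff)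
  refine stalkHom_eq.2 ⟨k, hk1, ?_⟩
  have hkk : k * f = k * f' := by
    ext z
    by_cases hz : z ∈ tsupport k.1
    · have : f.1 z = f'.1 z := (hk hz).2
      simp [this]
    · simp [image_eq_zero_of_notMem_tsupport hz]
  have aux : ∀ (g : Cc n M 𝕜) (z : E.Total), E.proj z ∉ tsupport k.1 →
      (((k * g).1 ∘ E.proj : E.Total → 𝕜) : Germ (𝓝 z) 𝕜) = 0 := by
    intro g z hz
    refine Quotient.sound ?_
    have := E.isLocalHomeomorph.continuous.continuousAt.eventually (Cc.eventually_zero k hz)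
    filter_upwards [this] with w hw
    change k.1 (E.proj w) * g.1 (E.proj w) = 0
    rw [hw, zero_mul]
  rw [smul_elF, smul_elF]
  refine Sh.Fn.ext (funext fun z => ?_)
  rw [elF_sec, elF_sec]
  by_cases hz : E.proj z ∈ tsupport k.1
  · obtain ⟨w, ⟨hw, hw'⟩, hwz⟩ := (hk hz).1
    by_cases h1 : z ∈ U
    · have : w = z := h.injOn hw h1 hwz
      subst this
      rw [el_mem _ h1, el_mem _ hw', hkk]
    · by_cases h2 : z ∈ U'
      · have : w = z := h'.injOn hw' h2 hwz
        subst this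
        exact absurd hw h1
      · rw [el_not_mem _ h1, el_not_mem _ h2]
  · have aux' : ∀ (V : Set E.Total) (g : Cc n M 𝕜), el E V (k * g) z = 0 := by
      intro V g
      by_cases hzV : z ∈ V
      · rw [el_mem _ hzV, aux g z hz]
      · rw [el_not_mem _ hzV]
    rw [aux', aux']

/-- Elementary functions vanishing near a point have germ zero. -/
theorem stalk_elF_zero {E : Sh n M} {U : Set E.Total} {f : Cc n M 𝕜} (h : IsEl E U f)
    {x : M} (hx : ∀ y ∈ U, E.proj y ≠ x) : stalkHom n 𝕜 x (elF h) = 0 := by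
  have hx' : x ∉ tsupport f.1 := by
    intro hc
    obtain ⟨y, hy, hyx⟩ := h.supp hc
    exact hx y hy hyx
  obtain ⟨k, hk, hk1⟩ := exists_bump (n := n) 𝕜 x
    ((isClosed_tsupport f.1).isOpen_compl.mem_nhds hx')
  refine stalkHom_eq_zero.2 ⟨k, hk1, ?_⟩
  rw [smul_elF]
  refine Sh.Fn.ext (funext fun z => ?_)
  have : k * f = 0 := by
    ext z
    by_cases hz : z ∈ tsupport k.1
    · simp [image_eq_zero_of_notMem_tsupport (show z ∉ tsupport f.1 from hk hz)]
    · simp [image_eq_zero_of_notMem_tsupport hz]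
  rw [elF_sec, map_zero, Pi.zero_apply, this]
  by_cases hz : z ∈ U
  · rw [el_mem _ hz]; rfl
  · rw [el_not_mem _ hz]

theorem exists_elementary_bump (𝕜 : Type) [RCLike 𝕜] {E : Sh n M} (x : M)
    (y : {y : E.Total // E.proj y = x}) : ∃ (U : Set E.Total) (η : Cc n M 𝕜), IsEl E U η ∧
      y.1 ∈ U ∧ ∀ᶠ z in 𝓝 x, η.1 z = 1 := by
  obtain ⟨U, hU, hy, hinj⟩ := exists_elementary E y.1
  obtain ⟨η, h1, h2⟩ := exists_bump (n := n) 𝕜 x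
    ((E.isLocalHomeomorph.isOpenMap U hU).mem_nhds ⟨y.1, hy, y.2⟩)
  exact ⟨U, η, ⟨hU, hinj, h1⟩, hy, h2⟩

/-- The elementary function with germ one at a point of the total space. -/
def unitAt {E : Sh n M} (x : M) (y : {y : E.Total // E.proj y = x}) : E.Fn 𝕜 :=
  elF (exists_elementary_bump 𝕜 x y).choose_spec.choose_spec.1

theorem stalk_elF_unitAt {E : Sh n M} {U : Set E.Total} {f : Cc n M 𝕜} (h : IsEl E U f)
    (x : M) (y : {y : E.Total // E.proj y = x}) (hy : y.1 ∈ U) :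
    stalkHom n 𝕜 x (f • unitAt x y) = stalkHom n 𝕜 x (elF h) := by
  have hs := (exists_elementary_bump 𝕜 x y).choose_spec.choose_spec
  rw [unitAt, smul_elF]
  refine stalk_elF_congr _ _ hs.2.1 hy y.2 ?_
  filter_upwards [hs.2.2] with z hz
  rw [Cc.mul_apply, hz, mul_one]

theorem omega_injective (E F : Sh n M) : Function.Injective (omega 𝕜 E F) := by
  have key : ∀ (x : M) (t : BTensor (Cc n M 𝕜) (E.Fn 𝕜) (F.Fn 𝕜)),
      theta (E := E.prod F) x (fun p => stalkHom n 𝕜 x (BTensor.tmul (Cc n M 𝕜)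
        (unitAt x ⟨(Sh.fst E F).toFun p.1, (proj_eq_fst p.1).symm.trans p.2⟩)
        (unitAt x ⟨(Sh.snd E F).toFun p.1, (proj_eq_snd p.1).symm.trans p.2⟩)))
        (omega 𝕜 E F t) = stalkHom n 𝕜 x t := by
    intro x t
    induction t using BTensor.induction_on with
    | h0 => rw [map_zero, theta_zero, map_zero]
    | h2 s t hs ht => rw [map_add, theta_add, map_add, hs, ht]
    | h1 u v =>
      induction u using Sh.Fn.induction with
      | h0 => rw [BTensor.zero_tmul, map_zero, theta_zero, map_zero]
      | hadd u u' hu hu' => rw [BTensor.add_tmul, map_add, theta_add, map_add, hu, hu']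
      | hel U f h =>
        induction v using Sh.Fn.induction with
        | h0 => rw [BTensor.tmul_zero, map_zero, theta_zero, map_zero]
        | hadd u u' hu hu' => rw [BTensor.tmul_add, map_add, theta_add, map_add, hu, hu']
        | hel V g h' =>
          rw [omega_elF]
          by_cases hU : ∃ y ∈ U, E.proj y = x
          · obtain ⟨y, hy, hyx⟩ := hU
            by_cases hV : ∃ z ∈ V, F.proj z = x
            · obtain ⟨z, hz, hzx⟩ := hV
              obtain ⟨p, rfl, rfl⟩ := exists_prod (hyx.trans hzx.symm)
              rw [theta_elF_mem x _ (h.prod h') ⟨p, (proj_eq_fst p).trans hyx⟩ ⟨hy, hz⟩]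
              rw [smul_stalkHom, nu_mul_smul, BTensor.smul_def_tmul, BTensor.smul_tmul,
                BTensor.smul_def_tmul]
              exact stalk_tmul_congr (stalk_elF_unitAt h x ⟨_, hyx⟩ hy)
                (stalk_elF_unitAt h' x ⟨_, hzx⟩ hz)
            · push Not at hV
              rw [theta_elF_not_mem x _ (h.prod h') (fun p hp hpx =>
                hV _ hp.2 ((proj_eq_snd p).symm.trans hpx))]
              rw [stalk_tmul_congr rfl ((stalk_elF_zero h' hV).trans (map_zero _).symm),
                BTensor.tmul_zero, map_zero]
          · push Not at hU
            rw [theta_elF_not_mem x _ (h.prod h') (fun p hp hpx =>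
              hU _ hp.1 ((proj_eq_fst p).symm.trans hpx))]
            rw [stalk_tmul_congr ((stalk_elF_zero h hU).trans (map_zero _).symm) rfl,
              BTensor.zero_tmul, map_zero]
  have hlu : ∀ t : BTensor (Cc n M 𝕜) (E.Fn 𝕜) (F.Fn 𝕜), ∃ r : Cc n M 𝕜, r • t = t := by
    intro t
    induction t using BTensor.induction_on with
    | h0 => exact ⟨0, nu_smul_zero _⟩
    | h1 u v =>
      obtain ⟨r, hr⟩ := Sh.Fn.isLocallyUnitary E {u}
      exact ⟨r, by rw [BTensor.smul_def_tmul, hr u (Finset.mem_singleton_self u)]⟩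
    | h2 u v hu hv =>
      obtain ⟨r, hr⟩ := hu
      obtain ⟨s, hs⟩ := hv
      refine ⟨r + s - r * s, ?_⟩
      rw [nu_smul_add, nu_sub_smul, nu_sub_smul, nu_add_smul, nu_add_smul, nu_mul_smul,
        nu_mul_smul, hs, nu_smul_comm, hr]
      abel
  refine (injective_iff_map_eq_zero _).2 fun t ht => ?_
  obtain ⟨r, hr⟩ := hlu t
  refine eq_zero_of_stalk r hr fun x => ?_
  rw [← key x t, ht, theta_zero]

end Comultiplication


noncomputable section SheafCoalgebra

variable {n : ℕ} {M : Type u} [TopologicalSpace M] [ChartedSpace (EuclideanSpace ℝ (Fin n)) M]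
  [IsManifold (𝓡 n) ∞ M] [T2Space M] {𝕜 : Type} [RCLike 𝕜]

/-- The isomorphism of abelian groups underlying `Ω`. -/
def omegaEquiv (E F : Sh n M) :
    BTensor (Cc n M 𝕜) (E.Fn 𝕜) (F.Fn 𝕜) ≃+ (E.prod F).Fn 𝕜 :=
  AddEquiv.ofBijective (omega 𝕜 E F).toAddMonoidHom ⟨omega_injective E F, omega_surjective E F⟩

variable (𝕜) in
/-- The comultiplication `Δ = Ω⁻¹ ∘ diag_+` of `C_c^∞(E)`. -/
def Sh.comul (E : Sh n M) :
    NULin (Cc n M 𝕜) (E.Fn 𝕜) (BTensor (Cc n M 𝕜) (E.Fn 𝕜) (E.Fn 𝕜)) where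
  toAddMonoidHom := (omegaEquiv E E).symm.toAddMonoidHom.comp (E.diag.push 𝕜).toAddMonoidHom
  map_smul' r u := by
    change (omegaEquiv E E).symm (E.diag.push 𝕜 (r • u)) =
      r • (omegaEquiv E E).symm (E.diag.push 𝕜 u)
    rw [AddEquiv.symm_apply_eq]
    change _ = omega 𝕜 E E (r • (omegaEquiv E E).symm (E.diag.push 𝕜 u))
    rw [NULin.map_smul, NULin.map_smul]
    congr 1
    exact ((omegaEquiv E E).apply_symm_apply _).symm

theorem Sh.omega_comul (E : Sh n M) (u : E.Fn 𝕜) :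
    omega 𝕜 E E (E.comul 𝕜 u) = E.diag.push 𝕜 u :=
  (omegaEquiv E E).apply_symm_apply _

theorem Sh.comul_elF (E : Sh n M) {U : Set E.Total} {f η : Cc n M 𝕜} (h : IsEl E U f)
    (hη : IsEl E U η) (hf : η * f = f) :
    E.comul 𝕜 (elF h) = BTensor.tmul _ (elF h) (elF hη) := by
  apply omega_injective E E
  rw [E.omega_comul, E.diag.push_elF, omega_elF]
  refine elF_congr _ _ ?_ (by rw [mul_comm, hf])
  ext p
  refine ⟨?_, ?_⟩
  · rintro ⟨y, hy, rfl⟩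
    exact ⟨hy, hy⟩
  · rintro ⟨h1, h2⟩
    refine ⟨_, h1, prod_ext rfl (h.injOn h1 h2 ?_)⟩
    rw [← proj_eq_fst, ← proj_eq_snd]

variable (𝕜) in
/-- The sheaf coalgebra `C_c^∞(E)` over `C_c^∞(M)`. -/
def Sh.coalg (E : Sh n M) : CoAlg.{u} (Cc n M 𝕜) where
  carrier := E.Fn 𝕜
  locallyUnitary := Sh.Fn.isLocallyUnitary E
  comul := E.comul 𝕜
  counit := E.counit 𝕜
  counit_comul u := by
    induction u using Sh.Fn.induction with
    | h0 => simp only [map_zero]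
    | hel U f h =>
      obtain ⟨η, hη, hf⟩ := h.exists_unit
      rw [E.comul_elF h hη hf, BTensor.map_tmul, BTensor.leftUnitor_tmul, E.counit_elF,
        NULin.id_apply, smul_elF]
      exact elF_congr _ _ rfl (by rw [mul_comm, hf])
    | hadd u v hu hv => simp only [map_add, hu, hv]
  comul_counit u := by
    induction u using Sh.Fn.induction with
    | h0 => simp only [map_zero]
    | hel U f h =>
      obtain ⟨η, hη, hf⟩ := h.exists_unit
      rw [E.comul_elF h hη hf, BTensor.map_tmul, BTensor.rightUnitor_tmul, E.counit_elF,
        NULin.id_apply, smul_elF]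
      exact elF_congr _ _ rfl hf
    | hadd u v hu hv => simp only [map_add, hu, hv]

variable (𝕜) in
/-- The coalgebra homomorphism `φ_+ : C_c^∞(E) → C_c^∞(F)` of a morphism of sheaves. -/
def Sh.Hom.coalgHom {E F : Sh n M} (φ : Sh.Hom E F) : CoAlg.Hom (E.coalg 𝕜) (F.coalg 𝕜) where
  lin := φ.push 𝕜
  comul_lin u := by
    change F.comul 𝕜 (φ.push 𝕜 u) = BTensor.map (φ.push 𝕜) (φ.push 𝕜) (E.comul 𝕜 u)
    induction u using Sh.Fn.induction with
    | h0 => simp only [map_zero]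
    | hel U f h =>
      obtain ⟨η, hη, hf⟩ := h.exists_unit
      rw [E.comul_elF h hη hf, BTensor.map_tmul, φ.push_elF, φ.push_elF,
        F.comul_elF (h.image φ) (hη.image φ) hf]
    | hadd u v hu hv => simp only [map_add, hu, hv]
  counit_lin u := by
    change F.counit 𝕜 (φ.push 𝕜 u) = E.counit 𝕜 u
    induction u using Sh.Fn.induction with
    | h0 => simp only [map_zero]
    | hel U f h => rw [φ.push_elF, F.counit_elF, E.counit_elF]
    | hadd u v hu hv => simp only [map_add, hu, hv]

variable (n M 𝕜) in
/-- The functor `C_c^∞` from sheaves on `M` to coalgebras over `C_c^∞(M)`. -/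
def ccFunctor : Sh n M ⥤ CoAlg.{u} (Cc n M 𝕜) where
  obj E := E.coalg 𝕜
  map φ := Sh.Hom.coalgHom 𝕜 φ
  map_id E := by
    refine CoAlg.Hom.ext (NULin.ext fun u => ?_)
    change Sh.Hom.push 𝕜 (𝟙 E : E ⟶ E) u = u
    induction u using Sh.Fn.induction with
    | h0 => simp only [map_zero]
    | hel U f h =>
      rw [Sh.Hom.push_elF]
      exact elF_congr _ _ (Set.image_id U) rfl
    | hadd u v hu hv => simp only [map_add, hu, hv]
  map_comp {E F G} φ ψ := by
    refine CoAlg.Hom.ext (NULin.ext fun u => ?_)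
    change Sh.Hom.push 𝕜 (φ ≫ ψ : E ⟶ G) u = Sh.Hom.push 𝕜 ψ (Sh.Hom.push 𝕜 φ u)
    induction u using Sh.Fn.induction with
    | h0 => simp only [map_zero]
    | hel U f h =>
      rw [Sh.Hom.push_elF, Sh.Hom.push_elF, Sh.Hom.push_elF]
      exact elF_congr _ _ (Set.image_comp ψ.toFun φ.toFun U) rfl
    | hadd u v hu hv => simp only [map_add, hu, hv]

end SheafCoalgebra

noncomputable section Spectral

variable {n : ℕ} {M : Type u} [TopologicalSpace M] [ChartedSpace (EuclideanSpace ℝ (Fin n)) M]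
  [IsManifold (𝓡 n) ∞ M] [T2Space M] {𝕜 : Type} [RCLike 𝕜]

/-- The map `α_x : C_x → D_x` induced by `α : C → D`. -/
def stalkMap (x : M) {C D : Type*} [AddCommGroup C] [NUModule (Cc n M 𝕜) C] [AddCommGroup D]
    [NUModule (Cc n M 𝕜) D] (α : NULin (Cc n M 𝕜) C D) :
    NULin (Cc n M 𝕜) (Stalk n 𝕜 x C) (Stalk n 𝕜 x D) where
  toAddMonoidHom := stalkLift ((stalkHom n 𝕜 x).comp α.toAddMonoidHom) (fun f c hf hc => by
    refine stalkHom_eq_zero.2 ⟨f, hf, ?_⟩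
    rw [← α.map_smul, hc, map_zero])
  map_smul' r t := by
    obtain ⟨c, rfl⟩ := stalkHom_surjective x t
    exact congrArg (stalkHom n 𝕜 x) (α.map_smul r c)

theorem stalkMap_stalkHom (x : M) {C D : Type*} [AddCommGroup C] [NUModule (Cc n M 𝕜) C]
    [AddCommGroup D] [NUModule (Cc n M 𝕜) D] (α : NULin (Cc n M 𝕜) C D) (c : C) :
    stalkMap x α (stalkHom n 𝕜 x c) = stalkHom n 𝕜 x (α c) := rfl

/-- The map `D_x → (C ⊗ D)_x`, `d_x ↦ (c ⊗ d)_x`. -/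
def stalkTmulRight (x : M) {C : Type*} (D : Type*) [AddCommGroup C] [NUModule (Cc n M 𝕜) C]
    [AddCommGroup D] [NUModule (Cc n M 𝕜) D] (c : C) :
    Stalk n 𝕜 x D →+ Stalk n 𝕜 x (BTensor (Cc n M 𝕜) C D) :=
  stalkLift ((stalkHom n 𝕜 x).comp (BTensor.mkHom c)) (fun f d hf hd => by
    refine stalkHom_eq_zero.2 ⟨f, hf, ?_⟩
    rw [BTensor.mkHom_apply, BTensor.smul_def_tmul, BTensor.smul_tmul, hd, BTensor.tmul_zero])

/-- The map `C → Hom(D_x, (C ⊗ D)_x)`. -/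
def stalkTmulLeft (x : M) (C D : Type*) [AddCommGroup C] [NUModule (Cc n M 𝕜) C]
    [AddCommGroup D] [NUModule (Cc n M 𝕜) D] :
    C →+ Stalk n 𝕜 x D →+ Stalk n 𝕜 x (BTensor (Cc n M 𝕜) C D) :=
  AddMonoidHom.mk' (stalkTmulRight x D) (fun c c' => by
    refine DFunLike.ext _ _ fun d => ?_
    obtain ⟨d, rfl⟩ := stalkHom_surjective x d
    exact (congrArg (stalkHom n 𝕜 x) (BTensor.add_tmul c c' d)).trans (map_add _ _ _))

/-- The canonical map `C_x ⊗ D_x → (C ⊗ D)_x`. -/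
def stalkTensor (x : M) (C D : Type*) [AddCommGroup C] [NUModule (Cc n M 𝕜) C] [AddCommGroup D]
    [NUModule (Cc n M 𝕜) D] :
    BTensor (Cc n M 𝕜) (Stalk n 𝕜 x C) (Stalk n 𝕜 x D) →+
      Stalk n 𝕜 x (BTensor (Cc n M 𝕜) C D) :=
  BTensor.lift
    (stalkLift (stalkTmulLeft x C D) (fun f c hf hc => by
      refine DFunLike.ext _ _ fun d => ?_
      obtain ⟨d, rfl⟩ := stalkHom_surjective x d
      refine stalkHom_eq_zero.2 ⟨f, hf, ?_⟩
      rw [BTensor.mkHom_apply, BTensor.smul_def_tmul, hc, BTensor.zero_tmul]))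
    (fun r c d => by
      obtain ⟨c, rfl⟩ := stalkHom_surjective x c
      obtain ⟨d, rfl⟩ := stalkHom_surjective x d
      exact congrArg (stalkHom n 𝕜 x) (BTensor.smul_tmul r c d))

theorem stalkTensor_map (x : M) {C D : Type*} [AddCommGroup C] [NUModule (Cc n M 𝕜) C]
    [AddCommGroup D] [NUModule (Cc n M 𝕜) D] (t : BTensor (Cc n M 𝕜) C D) :
    stalkTensor x C D (BTensor.map (stalkMk n 𝕜 x C) (stalkMk n 𝕜 x D) t) =
      stalkHom n 𝕜 x t := by
  induction t using BTensor.induction_on with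
  | h0 => simp only [map_zero]
  | h1 c d => rfl
  | h2 s t hs ht => simp only [map_add, hs, ht]

theorem stalk_tensor_smul_one {x : M} {C D : Type*} [AddCommGroup C] [NUModule (Cc n M 𝕜) C]
    [AddCommGroup D] [NUModule (Cc n M 𝕜) D] {f : Cc n M 𝕜} (hf : ∀ᶠ y in 𝓝 x, f.1 y = 1)
    (t : BTensor (Cc n M 𝕜) (Stalk n 𝕜 x C) (Stalk n 𝕜 x D)) : f • t = t := by
  induction t using BTensor.induction_on with
  | h0 => exact nu_smul_zero f
  | h1 c d => rw [BTensor.smul_def_tmul, stalk_smul_one hf]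
  | h2 s t hs ht => rw [nu_smul_add, hs, ht]

/-! ### Local coalgebras and grouplike elements

The ring of germs of smooth functions at `x` is the quotient of `C_c^∞(M)` by `N_x(C_c^∞(M))`, and
`C_c^∞(M)` acts on `C_x` through it. Hence the tensor product `C_x ⊗ C_x` over this ring is the
tensor product over `C_c^∞(M)`. -/

variable (C : CoAlg.{u} (Cc n M 𝕜))

/-- The comultiplication `Δ_x : C_x → C_x ⊗ C_x` induced by `Δ`. -/
def localComul (x : M) : Stalk n 𝕜 x C.carrier →+
    BTensor (Cc n M 𝕜) (Stalk n 𝕜 x C.carrier) (Stalk n 𝕜 x C.carrier) :=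
  stalkLift ((BTensor.map (stalkMk n 𝕜 x C.carrier)
      (stalkMk n 𝕜 x C.carrier)).toAddMonoidHom.comp C.comul.toAddMonoidHom)
    (fun f c hf hc => by
      rw [AddMonoidHom.comp_apply, ← stalk_tensor_smul_one hf (BTensor.map _ _ _),
        ← NULin.map_smul, ← NULin.map_smul, hc, map_zero, map_zero])

theorem localComul_stalkHom (x : M) (c : C.carrier) : localComul C x (stalkHom n 𝕜 x c) =
    BTensor.map (stalkMk n 𝕜 x C.carrier) (stalkMk n 𝕜 x C.carrier) (C.comul c) := rfl

/-- The germ at `x` of a function. -/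
def germHom (x : M) : Cc n M 𝕜 →+ Germ (𝓝 x) 𝕜 :=
  AddMonoidHom.mk' (fun f => (f.1 : Germ (𝓝 x) 𝕜)) (fun _ _ => rfl)

/-- The counit `ε_x` of `C_x` induced by `ε`, with values in the germs of functions at `x`. -/
def localCounit (x : M) : Stalk n 𝕜 x C.carrier →+ Germ (𝓝 x) 𝕜 :=
  stalkLift ((germHom x).comp C.counit.toAddMonoidHom) (fun f c hf hc => by
    have h : f * C.counit c = 0 := by
      rw [← nu_self_smul, ← NULin.map_smul, hc, map_zero]
    refine Quotient.sound ?_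
    filter_upwards [hf] with y hy
    have := congrFun (congrArg Subtype.val h) y
    change f.1 y * (C.counit c).1 y = 0 at this
    rwa [hy, one_mul] at this)

theorem localCounit_stalkHom (x : M) (c : C.carrier) : localCounit C x (stalkHom n 𝕜 x c) =
    ((C.counit c).1 : Germ (𝓝 x) 𝕜) := rfl

/-- The set `G(C_x)` of grouplike elements of the local coalgebra `C_x`. -/
def grouplike (x : M) : Set (Stalk n 𝕜 x C.carrier) :=
  {ζ | localComul C x ζ = BTensor.tmul _ ζ ζ ∧ localCounit C x ζ = 1}

/-- The weakly grouplike elements of `C`: `Δ(c) = c ⊗ c'` for some `c'`. -/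
def IsWeaklyGrouplike {C : CoAlg.{u} (Cc n M 𝕜)} (c : C.carrier) : Prop :=
  ∃ c' : C.carrier, C.comul c = BTensor.tmul _ c c'

/-- `c` is normalized on `W`: the germ of `ε(c)` at each point of `W` is one. -/
def IsNormalizedOn {C : CoAlg.{u} (Cc n M 𝕜)} (c : C.carrier) (W : Set M) : Prop :=
  ∀ x ∈ W, ((C.counit c).1 : Germ (𝓝 x) 𝕜) = 1

/-- The total space of the spectral sheaf: the disjoint union of the sets `G(C_x)`. -/
def SpecTotal : Type u := Σ x : M, grouplike C x

/-- The projection of the spectral sheaf. -/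
def specProj (p : SpecTotal C) : M := p.1

/-- The set `c_W` of the germs `c_x`, `x ∈ W`. -/
def basicSet {C : CoAlg.{u} (Cc n M 𝕜)} (c : C.carrier) (W : Set M) : Set (SpecTotal C) :=
  {p | p.1 ∈ W ∧ (p.2 : Stalk n 𝕜 p.1 C.carrier) = stalkHom n 𝕜 p.1 c}

/-- The sets `c_W` with `W` open and `c` weakly grouplike and normalized on `W`. -/
def basicSets : Set (Set (SpecTotal C)) :=
  {S | ∃ (c : C.carrier) (W : Set M), IsOpen W ∧ IsWeaklyGrouplike c ∧ IsNormalizedOn c W ∧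
    S = basicSet c W}

/-- The topology of the spectral sheaf is generated by the sets `c_W`. -/
instance : TopologicalSpace (SpecTotal C) := TopologicalSpace.generateFrom (basicSets C)

variable {C}

/-- Germs of normalized weakly grouplike elements are grouplike. -/
theorem IsWeaklyGrouplike.stalk_mem {c : C.carrier} (h : IsWeaklyGrouplike c) {x : M}
    (hx : ((C.counit c).1 : Germ (𝓝 x) 𝕜) = 1) : stalkHom n 𝕜 x c ∈ grouplike C x := by
  obtain ⟨c', hc'⟩ := h
  have h1 : C.counit c • c' = c := by
    have := C.counit_comul c
    rwa [hc', BTensor.map_tmul, BTensor.leftUnitor_tmul] at this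
  have h2 : stalkHom n 𝕜 x c = stalkHom n 𝕜 x c' := by
    rw [← stalk_smul_one (Germ.coe_eq.1 hx) (stalkHom n 𝕜 x c'), smul_stalkHom, h1]
  refine ⟨?_, hx⟩
  rw [localComul_stalkHom, hc', BTensor.map_tmul, stalkMk_apply, stalkMk_apply, ← h2]

/-- The sets `c_W` cover the spectral sheaf. -/
theorem exists_basicSet (p : SpecTotal C) {W : Set M} (hW : W ∈ 𝓝 p.1) :
    ∃ (c : C.carrier) (V : Set M), IsOpen V ∧ V ⊆ W ∧ IsWeaklyGrouplike c ∧
      IsNormalizedOn c V ∧ p ∈ basicSet c V := by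
  obtain ⟨x, ζ, hζ, hζ'⟩ := p
  obtain ⟨c, rfl⟩ := stalkHom_surjective x ζ
  have h1 : stalkHom n 𝕜 x (C.comul c) = stalkHom n 𝕜 x (BTensor.tmul _ c c) := by
    rw [← stalkTensor_map, ← stalkTensor_map]
    exact congrArg _ hζ
  obtain ⟨f, hf, hfc⟩ := stalkHom_eq.1 h1
  have hfe : ∀ᶠ y in 𝓝 x, f.1 y * (C.counit c).1 y = 1 := by
    filter_upwards [hf, Germ.coe_eq.1 hζ'] with y h2 h3
    rw [h2, h3, one_mul]
  obtain ⟨V, hV, hVo, hxV⟩ := mem_nhds_iff.1 (Filter.inter_mem hfe hW)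
  refine ⟨f • c, V, hVo, fun y hy => (hV hy).2, ⟨c, ?_⟩, ?_, hxV, ?_⟩
  · rw [NULin.map_smul, hfc, BTensor.smul_def_tmul]
  · intro y hy
    refine Quotient.sound ?_
    filter_upwards [hVo.mem_nhds hy] with z hz
    rw [NULin.map_smul]
    exact (hV hz).1
  · change stalkHom n 𝕜 x c = stalkHom n 𝕜 x (f • c)
    rw [← smul_stalkHom, stalk_smul_one hf]

/-- Equality of germs at a point implies equality of germs nearby. -/
theorem eventually_stalk_eq {A : Type*} [AddCommGroup A] [NUModule (Cc n M 𝕜) A] {c d : A} {x : M}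
    (h : stalkHom n 𝕜 x c = stalkHom n 𝕜 x d) :
    ∀ᶠ y in 𝓝 x, stalkHom n 𝕜 y c = stalkHom n 𝕜 y d := by
  obtain ⟨f, hf, hfc⟩ := stalkHom_eq.1 h
  filter_upwards [hf.eventually_nhds] with y hy
  exact stalkHom_eq.2 ⟨f, hy, hfc⟩

variable (C)

theorem isTopologicalBasis_basicSets : TopologicalSpace.IsTopologicalBasis (basicSets C) where
  exists_subset_inter := by
    rintro _ ⟨c, W, hW, hc, hcW, rfl⟩ _ ⟨d, V, hV, hd, hdV, rfl⟩ p ⟨⟨hpW, hpc⟩, ⟨hpV, hpd⟩⟩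
    obtain ⟨T, hT, hTo, hpT⟩ := mem_nhds_iff.1 (eventually_stalk_eq (hpc.symm.trans hpd))
    refine ⟨_, ⟨c, T ∩ (W ∩ V), hTo.inter (hW.inter hV), hc, fun x hx => hcW x hx.2.1, rfl⟩,
      ⟨⟨hpT, hpW, hpV⟩, hpc⟩, ?_⟩
    rintro q ⟨⟨hqT, hqW, hqV⟩, hqc⟩
    exact ⟨⟨hqW, hqc⟩, ⟨hqV, hqc.trans (hT hqT)⟩⟩
  sUnion_eq := by
    refine Set.eq_univ_of_forall fun p => ?_
    obtain ⟨c, V, hV, -, hc, hcV, hp⟩ := exists_basicSet p Filter.univ_mem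
    exact ⟨_, ⟨c, V, hV, hc, hcV, rfl⟩, hp⟩
  eq_generateFrom := rfl

theorem specProj_isLocalHomeomorph : IsLocalHomeomorph (specProj C) := by
  refine isLocalHomeomorph_of_open ?_ ?_ ?_
  · refine continuous_def.2 fun W hW => ?_
    refine (isTopologicalBasis_basicSets C).isOpen_iff.2 fun p hp => ?_
    obtain ⟨c, V, hV, hVW, hc, hcV, hpV⟩ := exists_basicSet p (hW.mem_nhds hp)
    exact ⟨_, ⟨c, V, hV, hc, hcV, rfl⟩, hpV, fun q hq => hVW hq.1⟩
  · refine (isTopologicalBasis_basicSets C).isOpenMap_iff.2 ?_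
    rintro _ ⟨c, W, hW, hc, hcW, rfl⟩
    convert hW
    ext x
    refine ⟨?_, fun hx => ?_⟩
    · rintro ⟨p, hp, rfl⟩
      exact hp.1
    · exact ⟨⟨x, stalkHom n 𝕜 x c, hc.stalk_mem (hcW x hx)⟩, ⟨hx, rfl⟩, rfl⟩
  · intro p
    obtain ⟨c, V, hV, -, hc, hcV, hp⟩ := exists_basicSet p Filter.univ_mem
    refine ⟨_, (isTopologicalBasis_basicSets C).isOpen ⟨c, V, hV, hc, hcV, rfl⟩, hp, ?_⟩
    rintro ⟨x, ζ, hζ⟩ hq ⟨x', ζ', hζ'⟩ hq' (rfl : x = x')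
    have : ζ = ζ' := hq.2.trans hq'.2.symm
    subst this
    rfl

/-- The spectral sheaf `E_sp(C)`, whose stalk at `x` is `G(C_x)`. -/
def spec : Sh n M := Sh.ofEtale (specProj C) (specProj_isLocalHomeomorph C)

variable {C} {D : CoAlg.{u} (Cc n M 𝕜)}

/-- Homomorphisms of coalgebras preserve grouplike elements of the local coalgebras. -/
theorem stalkMap_mem_grouplike (α : CoAlg.Hom C D) {x : M} {ζ : Stalk n 𝕜 x C.carrier}
    (hζ : ζ ∈ grouplike C x) : stalkMap x α.lin ζ ∈ grouplike D x := by
  obtain ⟨h1, h2⟩ := hζ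
  obtain ⟨c, rfl⟩ := stalkHom_surjective x ζ
  refine ⟨?_, ?_⟩
  · rw [localComul_stalkHom] at h1
    rw [stalkMap_stalkHom, localComul_stalkHom, α.comul_lin, ← BTensor.map_comp]
    have := congrArg (BTensor.map (stalkMap x α.lin) (stalkMap x α.lin)) h1
    rw [← BTensor.map_comp, BTensor.map_tmul, stalkMap_stalkHom] at this
    exact this
  · rw [stalkMap_stalkHom, localCounit_stalkHom, α.counit_lin]
    exact h2

/-- The map `E_sp(C) → E_sp(D)` given on the stalks by `α_x`. -/
def specMapFun (α : CoAlg.Hom C D) (p : SpecTotal C) : SpecTotal D :=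
  ⟨p.1, stalkMap p.1 α.lin p.2, stalkMap_mem_grouplike α p.2.2⟩

theorem specMapFun_continuous (α : CoAlg.Hom C D) : Continuous (specMapFun α) := by
  refine continuous_generateFrom_iff.2 ?_
  rintro _ ⟨d, V, hV, hd, hdV, rfl⟩
  refine (isTopologicalBasis_basicSets C).isOpen_iff.2 ?_
  rintro p ⟨hpV, hpd⟩
  obtain ⟨c, W, hW, -, hc, hcW, hpW⟩ := exists_basicSet p Filter.univ_mem
  have h1 : stalkHom n 𝕜 p.1 (α.lin c) = stalkHom n 𝕜 p.1 d := by
    rw [← stalkMap_stalkHom, ← hpW.2]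
    exact hpd
  obtain ⟨T, hT, hTo, hpT⟩ := mem_nhds_iff.1 (eventually_stalk_eq h1)
  refine ⟨_, ⟨c, T ∩ (W ∩ V), hTo.inter (hW.inter hV), hc, fun x hx => hcW x hx.2.1, rfl⟩,
    ⟨⟨hpT, hpW.1, hpV⟩, hpW.2⟩, ?_⟩
  rintro q ⟨⟨hqT, hqW, hqV⟩, hqc⟩
  refine ⟨hqV, ?_⟩
  change stalkMap q.1 α.lin (q.2 : Stalk n 𝕜 q.1 C.carrier) = stalkHom n 𝕜 q.1 d
  rw [hqc, stalkMap_stalkHom]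
  exact hT hqT

/-- The morphism of sheaves `E_sp(α)`. -/
def specMap (α : CoAlg.Hom C D) : Sh.Hom (spec C) (spec D) :=
  Sh.homOfContinuous (E := spec C) (F := spec D) (specMapFun α) (specMapFun_continuous α)
    (fun _ => rfl)

variable (n M 𝕜) in
/-- The spectral sheaf functor `E_sp` from coalgebras over `C_c^∞(M)` to sheaves on `M`. -/
def specFunctor : CoAlg.{u} (Cc n M 𝕜) ⥤ Sh n M where
  obj C := spec C
  map α := specMap α
  map_id C := by
    refine Sh.Hom.ext (funext ?_)
    rintro ⟨x, ζ, hζ⟩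
    obtain ⟨c, rfl⟩ := stalkHom_surjective x ζ
    rfl
  map_comp α β := by
    refine Sh.Hom.ext (funext ?_)
    rintro ⟨x, ζ, hζ⟩
    obtain ⟨c, rfl⟩ := stalkHom_surjective x ζ
    rfl

end Spectral

end SheafCoalg

namespace SheafCoalg

noncomputable section Adjunction

variable {n : ℕ} {M : Type u} [TopologicalSpace M] [ChartedSpace (EuclideanSpace ℝ (Fin n)) M]
  [IsManifold (𝓡 n) ∞ M] [T2Space M] {𝕜 : Type} [RCLike 𝕜]

/-! ### Elements of locally unitary modules and their germs -/

/-! Everything is checked on germs. An element $c$ of a locally unitary module is determined by its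
germs $c_x$ (`IsLocallyUnitary.eq_of_stalk`), and $C_c^\infty(E)$ is generated additively by the
elementary functions `elF h`, that is, $f\circ\pi$ on an open set $U$ on which $\pi$ is injective,
with the support of $f$ inside $\pi(U)$. An identity between homomorphisms therefore reduces to one
computation with an elementary function at a point of $M$.

The counit of the adjunction sends $u\in C_c^\infty(\mathcal{E}_{sp}(C))$ to the element $c\in C$
with $c_x=\sum_p u_p\,\zeta_p$, the sum being over the points $p$ above $x$ and $\zeta_p\in G(C_x)$
being the germ that $p$ is. Uniqueness of $c$ is clear from the above. Existence
(`exists_stalk_eq_theta`) is the place where the topology of the spectral sheaf enters: on a basic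
set $c_W$ the points are the germs of a single element $c$ of the coalgebra, so a function supported
there is realized by a multiple of $c$, and compactness of the support allows finitely many such
elements to be combined. That the resulting map respects $\epsilon$ and $\Delta$ (`counit_evalHom`,
`comul_evalHom`) is the grouplike identity $\Delta_x(\zeta)=\zeta\otimes\zeta$,
$\epsilon_x(\zeta)=1$ at each point.

The unit sends $y\in E$ to the germ at $\pi(y)$ of an elementary function equal to one near $y$. The
two triangle identities (`evalLin_push_toSpec`, `specMapFun_evalCoalg_toSpecFun`) then hold on
generators.

Full faithfulness of the left adjoint amounts to the unit being an isomorphism, and a bijective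
morphism of sheaves is one. Surjectivity is the essential point: every grouplike germ of
$C_c^\infty(E)$ at $x$ comes from exactly one $y$ over $x$. Applying $\Omega$ to
$\Delta_x(u)=u\otimes u$ gives an equation between $\mathrm{diag}_+(u)$ and $\Omega(u\otimes u)$
over $x$. On the diagonal it reads $u_y=u_y^2$, so that $u_y$ is $0$ or $1$ by continuity; off the
diagonal it reads $0=u_y u_z$, so that at most one $u_y$ is $1$; and $\epsilon_x(u)=1$ prevents all
of them from vanishing. -/

/-- Elements of a locally unitary module are determined by their germs. -/
theorem IsLocallyUnitary.eq_of_stalk {C : Type*} [AddCommGroup C] [NUModule (Cc n M 𝕜) C]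
    (hC : IsLocallyUnitary (Cc n M 𝕜) C) {c d : C}
    (h : ∀ x : M, stalkHom n 𝕜 x c = stalkHom n 𝕜 x d) : c = d := by
  obtain ⟨r, hr⟩ := hC {c - d}
  refine sub_eq_zero.1 (eq_zero_of_stalk r (hr _ (Finset.mem_singleton_self _)) fun x => ?_)
  rw [map_sub, h, sub_self]

/-- The tensor product of two modules is locally unitary if the first factor is. -/
theorem IsLocallyUnitary.bTensor {R C D : Type*} [NonUnitalCommRing R] [AddCommGroup C]
    [AddCommGroup D] [NUModule R C] [NUModule R D] (hC : IsLocallyUnitary R C) :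
    IsLocallyUnitary R (BTensor R C D) := by
  refine isLocallyUnitary_of_forall fun t => ?_
  induction t using BTensor.induction_on with
  | h0 => exact ⟨0, nu_smul_zero _⟩
  | h1 c d =>
    obtain ⟨r, hr⟩ := hC {c}
    exact ⟨r, by rw [BTensor.smul_def_tmul, hr c (Finset.mem_singleton_self c)]⟩
  | h2 s t hs ht =>
    obtain ⟨r, hr⟩ := hs
    obtain ⟨r', hr'⟩ := ht
    refine ⟨r + r' - r * r', ?_⟩
    rw [nu_smul_add, nu_sub_smul, nu_sub_smul, nu_add_smul, nu_add_smul, nu_mul_smul,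
      nu_mul_smul, hr', nu_smul_comm, hr]
    abel

theorem stalk_smul_zero {C : Type*} [AddCommGroup C] [NUModule (Cc n M 𝕜) C] {x : M}
    {f : Cc n M 𝕜} (hf : x ∉ tsupport f.1) (t : Stalk n 𝕜 x C) : f • t = 0 := by
  rw [stalk_smul_congr (g := 0) (Cc.eventually_zero f hf), nu_zero_smul]

theorem tsupport_mul_subset_left (f g : Cc n M 𝕜) : tsupport (f * g).1 ⊆ tsupport f.1 := by
  refine closure_mono fun y hy => ?_
  simp only [Function.mem_support, Cc.mul_apply] at hy
  exact left_ne_zero_of_mul hy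

theorem localCounit_smul (C : CoAlg.{u} (Cc n M 𝕜)) (x : M) (f : Cc n M 𝕜)
    (t : Stalk n 𝕜 x C.carrier) :
    localCounit C x (f • t) = (f.1 : Germ (𝓝 x) 𝕜) * localCounit C x t := by
  obtain ⟨c, rfl⟩ := stalkHom_surjective x t
  rw [smul_stalkHom, localCounit_stalkHom, localCounit_stalkHom, NULin.map_smul]
  rfl

/-- The comultiplication can be computed on the germs. -/
theorem stalkHom_comul (C : CoAlg.{u} (Cc n M 𝕜)) (x : M) (c : C.carrier) :
    stalkHom n 𝕜 x (C.comul c) =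
      stalkTensor x C.carrier C.carrier (localComul C x (stalkHom n 𝕜 x c)) := by
  rw [localComul_stalkHom, stalkTensor_map]

/-! ### The counit of the adjunction -/

/-- The element of `C_x` underlying a point of the spectral sheaf over `x`. -/
def specGerm (C : CoAlg.{u} (Cc n M 𝕜)) (x : M)
    (p : {p : (spec C).Total // (spec C).proj p = x}) : Stalk n 𝕜 x C.carrier :=
  p.2 ▸ (show SpecTotal C from p.1).2.1

variable {C D : CoAlg.{u} (Cc n M 𝕜)}

/-- Only one point of an elementary set lies over a given point of $M$, so the fibre sum has a
single term. Taking `p.1` itself as the base point makes the transport in `specGerm` trivial. -/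
theorem theta_specGerm_mem {U : Set (spec C).Total} {f : Cc n M 𝕜} (h : IsEl (spec C) U f)
    {p : SpecTotal C} (hp : p ∈ (show Set (SpecTotal C) from U)) :
    theta p.1 (specGerm C p.1) (elF h) = f • p.2.1 :=
  theta_elF_mem p.1 (specGerm C p.1) h ⟨p, rfl⟩ hp

/-- Sections with compact support of the spectral sheaf, weighted by smooth functions, come from
elements of the coalgebra. -/
theorem exists_stalk_eq_theta (u : (spec C).Fn 𝕜) :
    ∃ c : C.carrier, ∀ x, stalkHom n 𝕜 x c = theta x (specGerm C x) u := by
  induction u using Sh.Fn.induction with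
  | h0 => exact ⟨0, fun x => by rw [map_zero, theta_zero]⟩
  | hadd u v hu hv =>
    obtain ⟨c, hc⟩ := hu
    obtain ⟨d, hd⟩ := hv
    exact ⟨c + d, fun x => by rw [map_add, theta_add, hc, hd]⟩
  | hel U f h =>
    -- The multiplier `ρ` is required to work for every `g` supported in the image of `U`, not only
    -- for `f`: when two compact pieces are joined, it is applied to the product `σ * g`.
    have key : ∃ ρ : Cc n M 𝕜, (∀ y ∈ tsupport f.1, ρ.1 y = 1) ∧
        ∀ (g : Cc n M 𝕜) (hg : IsEl (spec C) U g), ∃ c : C.carrier, ∀ x,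
          stalkHom n 𝕜 x c = theta x (specGerm C x) (elF (hg.mul ρ)) := by
      refine (Cc.compact f).isCompact.induction_on
        (p := fun K => ∃ ρ : Cc n M 𝕜, (∀ y ∈ K ∩ tsupport f.1, ρ.1 y = 1) ∧
          ∀ (g : Cc n M 𝕜) (hg : IsEl (spec C) U g), ∃ c : C.carrier, ∀ x,
            stalkHom n 𝕜 x c = theta x (specGerm C x) (elF (hg.mul ρ))) ?_ ?_ ?_ ?_ |>.imp
        fun ρ hρ => ⟨fun y hy => hρ.1 y ⟨hy, hy⟩, hρ.2⟩
      · refine ⟨0, by simp, fun g hg => ⟨0, fun x => ?_⟩⟩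
        rw [← smul_elF hg 0, nu_zero_smul, map_zero, theta_zero]
      · rintro s t hst ⟨ρ, h1, h2⟩
        exact ⟨ρ, fun y hy => h1 y ⟨hst hy.1, hy.2⟩, h2⟩
      · rintro s t ⟨ρ, h1, h2⟩ ⟨σ, h3, h4⟩
        -- This is $1-(1-\rho)(1-\sigma)$, which is one wherever `ρ` or `σ` is. The product term is
        -- realized by applying the property of `ρ` to `σ * g`.
        refine ⟨ρ + σ - ρ * σ, ?_, fun g hg => ?_⟩
        · rintro y ⟨hy | hy, hyf⟩
          · simp [h1 y ⟨hy, hyf⟩]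
          · simp [h3 y ⟨hy, hyf⟩]
        · obtain ⟨c, hc⟩ := h2 g hg
          obtain ⟨d, hd⟩ := h4 g hg
          obtain ⟨e, he⟩ := h2 (σ * g) (hg.mul σ)
          refine ⟨c + d - e, fun x => ?_⟩
          have e1 : elF (hg.mul ρ) + elF (hg.mul σ) =
              elF (hg.mul (ρ + σ - ρ * σ)) + elF ((hg.mul σ).mul ρ) := by
            rw [← smul_elF hg ρ, ← smul_elF hg σ, ← smul_elF hg (ρ + σ - ρ * σ),
              ← smul_elF (hg.mul σ) ρ, ← smul_elF hg σ, nu_sub_smul, nu_add_smul, nu_mul_smul]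
            abel
          rw [map_sub, map_add, hc, hd, he, ← theta_add, e1, theta_add, add_sub_cancel_right]
      · intro x hx
        obtain ⟨p, hp, rfl⟩ := h.supp hx
        -- The point `p` has a basic neighbourhood $c_V$ inside `U`. With the support of `ρ` in `V`,
        -- the element `(ρ * g) • c` is the one required: over `V` the point of `U` is the germ of
        -- `c`, and away from `V` both sides vanish.
        obtain ⟨_, ⟨c, V, hV, hc, hcV, rfl⟩, hpV, hVU⟩ :=
          (isTopologicalBasis_basicSets C).exists_subset_of_mem_open hp h.isOpen
        obtain ⟨ρ, h1, h2⟩ := exists_bump (n := n) 𝕜 (p : SpecTotal C).1 (hV.mem_nhds hpV.1)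
        refine ⟨_, mem_nhdsWithin_of_mem_nhds h2, ρ, fun y hy => hy.1, fun g hg =>
          ⟨(ρ * g) • c, fun x => ?_⟩⟩
        by_cases hxV : x ∈ V
        · let q : SpecTotal C := ⟨x, stalkHom n 𝕜 x c, hc.stalk_mem (hcV x hxV)⟩
          exact (theta_specGerm_mem (hg.mul ρ) (p := q) (hVU ⟨hxV, rfl⟩)).symm
        · have hx0 : x ∉ tsupport (ρ * g).1 := fun hc => hxV (h1 (tsupport_mul_subset_left _ _ hc))
          rw [← smul_stalkHom, stalk_smul_zero hx0]
          by_cases hxU : ∃ q ∈ U, (spec C).proj q = x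
          · obtain ⟨q, hq, rfl⟩ := hxU
            exact ((theta_specGerm_mem (hg.mul ρ) hq).trans (stalk_smul_zero hx0 _)).symm
          · push Not at hxU
            rw [theta_elF_not_mem _ _ _ hxU]
    obtain ⟨ρ, h1, h2⟩ := key
    obtain ⟨c, hc⟩ := h2 f h
    refine ⟨c, fun x => (hc x).trans (congrArg _ (elF_congr _ _ rfl ?_))⟩
    ext y
    by_cases hy : y ∈ tsupport f.1
    · simp [h1 y hy]
    · simp [image_eq_zero_of_notMem_tsupport hy]

theorem CoAlg.eq_of_stalk (C : CoAlg.{u} (Cc n M 𝕜)) {c d : C.carrier}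
    (h : ∀ x : M, stalkHom n 𝕜 x c = stalkHom n 𝕜 x d) : c = d :=
  C.locallyUnitary.eq_of_stalk h

/-- The additive map underlying the counit `C_c^∞(E_sp(C)) → C` of the adjunction. -/
def evalHom (C : CoAlg.{u} (Cc n M 𝕜)) : (spec C).Fn 𝕜 →+ C.carrier :=
  -- The chosen element is the only one with the prescribed germs, so additivity is inherited from
  -- `theta`.
  AddMonoidHom.mk' (fun u => (exists_stalk_eq_theta u).choose) (fun u v => C.eq_of_stalk fun x => by
    rw [map_add, (exists_stalk_eq_theta u).choose_spec, (exists_stalk_eq_theta v).choose_spec,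
      (exists_stalk_eq_theta (u + v)).choose_spec, theta_add])

theorem stalkHom_evalHom (u : (spec C).Fn 𝕜) (x : M) :
    stalkHom n 𝕜 x (evalHom C u) = theta x (specGerm C x) u :=
  (exists_stalk_eq_theta u).choose_spec x

/-- With `stalkHom_evalHom_not_mem` this gives all the germs of the image of an elementary function;
every later property of the counit of the adjunction is read off from these two formulas. -/
theorem stalkHom_evalHom_mem {U : Set (spec C).Total} {f : Cc n M 𝕜} (h : IsEl (spec C) U f)
    {p : SpecTotal C} (hp : p ∈ (show Set (SpecTotal C) from U)) :
    stalkHom n 𝕜 p.1 (evalHom C (elF h)) = f • p.2.1 := by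
  rw [stalkHom_evalHom, theta_specGerm_mem h hp]

theorem stalkHom_evalHom_not_mem {U : Set (spec C).Total} {f : Cc n M 𝕜} (h : IsEl (spec C) U f)
    {x : M} (hx : ∀ p ∈ U, (spec C).proj p ≠ x) :
    stalkHom n 𝕜 x (evalHom C (elF h)) = 0 := by
  rw [stalkHom_evalHom, theta_elF_not_mem _ _ _ hx]

/-- The elements of a coalgebra that come from an elementary subset of its spectral sheaf. -/
theorem evalHom_elF_eq {U : Set (spec C).Total} {f : Cc n M 𝕜} (h : IsEl (spec C) U f)
    {c : C.carrier} (hU : ∀ p : SpecTotal C, p ∈ (show Set (SpecTotal C) from U) →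
      stalkHom n 𝕜 p.1 c = f • p.2.1)
    (h0 : ∀ x, (∀ p ∈ U, (spec C).proj p ≠ x) → stalkHom n 𝕜 x c = 0) :
    evalHom C (elF h) = c := by
  refine C.eq_of_stalk fun x => ?_
  by_cases hx : ∃ p ∈ U, (spec C).proj p = x
  · obtain ⟨p, hp, rfl⟩ := hx
    exact (stalkHom_evalHom_mem h hp).trans (hU p hp).symm
  · push Not at hx
    rw [stalkHom_evalHom_not_mem h hx, h0 x hx]

/-! ### Compatibility of the evaluation map with the coalgebra structure -/

/-- The linear map underlying the counit `C_c^∞(E_sp(C)) → C` of the adjunction. -/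
def evalLin (C : CoAlg.{u} (Cc n M 𝕜)) : NULin (Cc n M 𝕜) ((spec C).Fn 𝕜) C.carrier where
  toAddMonoidHom := evalHom C
  map_smul' r u := by
    change evalHom C (r • u) = r • evalHom C u
    induction u using Sh.Fn.induction with
    | h0 => simp only [nu_smul_zero, map_zero]
    | hadd u v hu hv => simp only [nu_smul_add, map_add, hu, hv]
    | hel U f h =>
      rw [smul_elF]
      refine evalHom_elF_eq _ (fun p hp => ?_) (fun x hx => ?_)
      · rw [← smul_stalkHom, stalkHom_evalHom_mem h hp, nu_mul_smul]
      · rw [← smul_stalkHom, stalkHom_evalHom_not_mem h hx, nu_smul_zero]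

/-- Over a point $p$ of `U` the germ is $f\zeta$ with $\zeta$ grouplike, and
$\epsilon_x(f\zeta)=f\,\epsilon_x(\zeta)=f$. Over the remaining points both sides have germ zero,
because the support of `f` lies in the image of `U`. -/
theorem counit_evalHom {U : Set (spec C).Total} {f : Cc n M 𝕜} (h : IsEl (spec C) U f) :
    C.counit (evalHom C (elF h)) = f := by
  refine Subtype.ext (funext fun x => ?_)
  -- Two functions with the same germ at `x` have the same value at `x`, so it is enough to compare
  -- germs.
  refine Eventually.self_of_nhds (p := fun x => (C.counit (evalHom C (elF h))).1 x = f.1 x)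
    (Germ.coe_eq.1 ?_)
  rw [← localCounit_stalkHom]
  by_cases hx : ∃ p ∈ U, (spec C).proj p = x
  · obtain ⟨p, hp, rfl⟩ := hx
    exact (congrArg _ (stalkHom_evalHom_mem h hp)).trans ((localCounit_smul C _ f _).trans
      ((congrArg _ (p : SpecTotal C).2.2.2).trans (mul_one _)))
  · push Not at hx
    rw [stalkHom_evalHom_not_mem h hx, map_zero, Cc.germ_eq_zero]
    intro hc
    obtain ⟨p, hp, hpx⟩ := h.supp hc
    exact hx p hp hpx

/-- The tensor product is locally unitary, so germs suffice, and there
$\Delta_x(f\zeta)=f(\zeta\otimes\zeta)=(\eta f)\zeta\otimes\zeta=f\zeta\otimes\eta\zeta$. The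
comparison takes place after the canonical map $C_x\otimes C_x\to(C\otimes C)_x$; that this map
exists is enough, and its injectivity plays no role. -/
theorem comul_evalHom {U : Set (spec C).Total} {f η : Cc n M 𝕜} (h : IsEl (spec C) U f)
    (hη : IsEl (spec C) U η) (hf : η * f = f) :
    C.comul (evalHom C (elF h)) = BTensor.tmul _ (evalHom C (elF h)) (evalHom C (elF hη)) := by
  refine C.locallyUnitary.bTensor.eq_of_stalk fun x => ?_
  rw [stalkHom_comul, ← stalkTensor_map, BTensor.map_tmul, stalkMk_apply, stalkMk_apply]
  by_cases hx : ∃ p ∈ U, (spec C).proj p = x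
  · obtain ⟨p, hp, rfl⟩ := hx
    change stalkTensor (p : SpecTotal C).1 _ _ (localComul C (p : SpecTotal C).1
      (stalkHom n 𝕜 (p : SpecTotal C).1 _)) = stalkTensor (p : SpecTotal C).1 _ _
      (BTensor.tmul _ (stalkHom n 𝕜 (p : SpecTotal C).1 _) (stalkHom n 𝕜 (p : SpecTotal C).1 _))
    rw [stalkHom_evalHom_mem h hp, stalkHom_evalHom_mem hη hp]
    obtain ⟨x, ζ, hζ, hζ'⟩ := (p : SpecTotal C)
    have e1 : localComul C x (f • ζ) = f • localComul C x ζ := by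
      obtain ⟨c, rfl⟩ := stalkHom_surjective x ζ
      rw [smul_stalkHom, localComul_stalkHom, localComul_stalkHom, NULin.map_smul, NULin.map_smul]
    change stalkTensor x _ _ (localComul C x (f • ζ)) =
      stalkTensor x _ _ (BTensor.tmul _ (f • ζ) (η • ζ))
    -- The factor `η` moves from the right tensor factor to the left one, where it is absorbed by
    -- `f`.
    rw [e1, hζ, BTensor.smul_def_tmul, ← BTensor.smul_tmul, ← nu_mul_smul, hf]
  · push Not at hx
    rw [stalkHom_evalHom_not_mem h hx, map_zero, BTensor.zero_tmul]

/-- The counit `C_c^∞(E_sp(C)) → C` of the adjunction. -/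
def evalCoalg (C : CoAlg.{u} (Cc n M 𝕜)) : CoAlg.Hom ((spec C).coalg 𝕜) C where
  lin := evalLin C
  comul_lin u := by
    change C.comul (evalLin C u) = BTensor.map (evalLin C) (evalLin C) ((spec C).comul 𝕜 u)
    induction u using Sh.Fn.induction with
    | h0 => simp only [map_zero]
    | hadd u v hu hv => simp only [map_add, hu, hv]
    | hel U f h =>
      obtain ⟨η, hη, hf⟩ := h.exists_unit
      rw [(spec C).comul_elF h hη hf, BTensor.map_tmul]
      exact comul_evalHom h hη hf
  counit_lin u := by
    change C.counit (evalLin C u) = (spec C).counit 𝕜 u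
    induction u using Sh.Fn.induction with
    | h0 => simp only [map_zero]
    | hadd u v hu hv => simp only [map_add, hu, hv]
    | hel U f h => rw [(spec C).counit_elF]; exact counit_evalHom h

/-- Pushing an elementary function forward keeps `f` and moves `U` to its image, whose points are
the germs $\alpha_x(\zeta)$. Linearity of $\alpha_x$ gives $\alpha_x(f\zeta)=f\,\alpha_x(\zeta)$. -/
theorem evalLin_naturality (α : CoAlg.Hom C D) (u : (spec C).Fn 𝕜) :
    evalLin D ((specMap α).push 𝕜 u) = α.lin (evalLin C u) := by
  induction u using Sh.Fn.induction with
  | h0 => simp only [map_zero]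
  | hadd u v hu hv => simp only [map_add, hu, hv]
  | hel U f h =>
    rw [Sh.Hom.push_elF]
    refine evalHom_elF_eq _ ?_ (fun x hx => ?_)
    · rintro _ ⟨p, hp, rfl⟩
      refine Eq.trans (congrArg (stalkMap (p : SpecTotal C).1 α.lin) (stalkHom_evalHom_mem h hp)) ?_
      exact (stalkMap (p : SpecTotal C).1 α.lin).map_smul f (p : SpecTotal C).2.1
    · refine Eq.trans (congrArg (stalkMap x α.lin) (stalkHom_evalHom_not_mem h fun p hp hpx => ?_))
        (map_zero _)
      exact hx _ ⟨p, hp, rfl⟩ hpx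

/-! ### Germs of sections of a sheaf -/

variable {E F : Sh n M}

/-- An element of `C_c^∞(E)` has the same germ at `x` as the one which is prescribed by its germs
at the points over `x`. -/
theorem theta_unitAt (x : M) (u : E.Fn 𝕜) :
    theta x (fun y => stalkHom n 𝕜 x (unitAt x y)) u = stalkHom n 𝕜 x u := by
  induction u using Sh.Fn.induction with
  | h0 => rw [theta_zero, map_zero]
  | hadd u v hu hv => rw [theta_add, map_add, hu, hv]
  | hel U f h =>
    by_cases hx : ∃ y ∈ U, E.proj y = x
    · obtain ⟨y, hy, hyx⟩ := hx
      rw [theta_elF_mem x _ h ⟨y, hyx⟩ hy, smul_stalkHom, stalk_elF_unitAt h x ⟨y, hyx⟩ hy]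
    · push Not at hx
      rw [theta_elF_not_mem x _ h hx, stalk_elF_zero h hx]

/-- By `theta_unitAt` the class in $C_c^\infty(E)_x$ is a sum over the fibre whose terms depend only
on the germs of the section there. Together with the converse `sec_eq_of_stalkHom_eq`, this
translates equations in the local module into equations between germs at the points over $x$. -/
theorem stalkHom_eq_of_sec {x : M} {u v : E.Fn 𝕜}
    (h : ∀ y, E.proj y = x → u.sec y = v.sec y) : stalkHom n 𝕜 x u = stalkHom n 𝕜 x v := by
  rw [← theta_unitAt, ← theta_unitAt]
  exact finsum_congr fun y => by rw [h y.1 y.2]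

theorem smul_sec_of_eventually_one {f : Cc n M 𝕜} {y : E.Total}
    (hf : ∀ᶠ z in 𝓝 (E.proj y), f.1 z = 1) (u : E.Fn 𝕜) : (f • u).sec y = u.sec y := by
  have : ((f.1 ∘ E.proj : E.Total → 𝕜) : Germ (𝓝 y) 𝕜) = 1 :=
    Quotient.sound (E.isLocalHomeomorph.continuous.continuousAt.eventually hf)
  rw [Sh.Fn.smul_sec, smulSec, this, one_mul]

/-- Equality in the local module means equality after multiplication by a function that is one near
`x`, and such a multiplication leaves the germs over `x` unchanged. -/
theorem sec_eq_of_stalkHom_eq {x : M} {u v : E.Fn 𝕜} (h : stalkHom n 𝕜 x u = stalkHom n 𝕜 x v)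
    {y : E.Total} (hy : E.proj y = x) : u.sec y = v.sec y := by
  subst hy
  obtain ⟨f, hf, hfu⟩ := stalkHom_eq.1 h
  rw [← smul_sec_of_eventually_one hf u, hfu, smul_sec_of_eventually_one hf v]

/-- The germs in use are germs of arbitrary functions, so continuity has to be recovered from the
description by elementary functions. It is what forces idempotent germs to be constant. -/
theorem Sh.Fn.exists_continuous_sec (u : E.Fn 𝕜) (y : E.Total) :
    ∃ g : E.Total → 𝕜, Continuous g ∧ u.sec y = (g : Germ (𝓝 y) 𝕜) := by
  induction u using Sh.Fn.induction with
  | h0 => exact ⟨0, continuous_zero, by rw [map_zero]; rfl⟩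
  | hel U f h =>
    by_cases hy : y ∈ U
    · exact ⟨_, (Cc.smooth f).continuous.comp E.isLocalHomeomorph.continuous,
        by rw [elF_sec, el_mem f hy]⟩
    · exact ⟨0, continuous_zero, by rw [elF_sec, el_not_mem f hy]; rfl⟩
  | hadd u v hu hv =>
    obtain ⟨f, hf, hf'⟩ := hu
    obtain ⟨g, hg, hg'⟩ := hv
    exact ⟨f + g, hf.add hg, by rw [map_add, Pi.add_apply, hf', hg']; rfl⟩

/-- An idempotent germ of a continuous function is zero or one. -/
theorem eq_zero_or_one_of_isIdempotentElem {X : Type*} [TopologicalSpace X] {y : X} {g : X → 𝕜}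
    (hg : Continuous g) (h : IsIdempotentElem (g : Germ (𝓝 y) 𝕜)) :
    (g : Germ (𝓝 y) 𝕜) = 0 ∨ (g : Germ (𝓝 y) 𝕜) = 1 := by
  have h' : ∀ᶠ z in 𝓝 y, g z * g z = g z := Germ.coe_eq.1 h
  have h01 : ∀ᶠ z in 𝓝 y, g z = 0 ∨ g z = 1 :=
    h'.mono fun z hz => IsIdempotentElem.iff_eq_zero_or_one.1 hz
  rcases h01.self_of_nhds with hy | hy
  · left
    refine Quotient.sound ?_
    -- Near `y` the function takes only the values zero and one, and by continuity it avoids the one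
    -- it does not take at `y`.
    filter_upwards [h01, hg.continuousAt.eventually_ne (hy.trans_ne zero_ne_one)] with z hz hz'
    exact hz.resolve_right hz'
  · right
    refine Quotient.sound ?_
    filter_upwards [h01, hg.continuousAt.eventually_ne (hy.trans_ne one_ne_zero)] with z hz hz'
    exact hz.resolve_left hz'

/-- For injective $\phi$ the sum defining $\phi_+(u)$ at $\phi(y)$ has only the term at $y$. The
case of interest is the diagonal. -/
theorem pullGerm_push_sec (φ : Sh.Hom E F) (hφ : Function.Injective φ.toFun) (u : E.Fn 𝕜)
    (y : E.Total) : pullGerm φ.smooth.continuous y ((φ.push 𝕜 u).sec (φ.toFun y)) = u.sec y := by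
  induction u using Sh.Fn.induction with
  | h0 => simp only [map_zero]; rfl
  | hadd u v hu hv => simp only [map_add, Pi.add_apply, pullGerm_add, hu, hv]
  | hel U f h =>
    rw [φ.push_elF, elF_sec, elF_sec]
    by_cases hy : y ∈ U
    · rw [el_mem f hy, el_mem f (Set.mem_image_of_mem _ hy)]
      refine Quotient.sound (Eventually.of_forall fun w => ?_)
      exact congrArg f.1 (φ.proj_toFun w)
    · rw [el_not_mem f hy, el_not_mem f (fun hc => hy ((hφ.mem_set_image).1 hc))]
      rfl

theorem push_sec_of_notMem_range (φ : Sh.Hom E F) (u : E.Fn 𝕜) {z : F.Total}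
    (hz : z ∉ Set.range φ.toFun) : (φ.push 𝕜 u).sec z = 0 := by
  have : IsEmpty {y : E.Total // φ.toFun y = z} := ⟨fun y => hz ⟨y.1, y.2⟩⟩
  exact finsum_of_isEmpty _

theorem value_mul_germ {X : Type*} [TopologicalSpace X] {y : X} (g g' : Germ (𝓝 y) 𝕜) :
    (g * g').value = g.value * g'.value := map_mul Germ.valueRingHom g g'

theorem value_pullGerm {X Y : Type*} [TopologicalSpace X] [TopologicalSpace Y] {φ : X → Y}
    (hφ : Continuous φ) (y : X) (g : Germ (𝓝 (φ y)) 𝕜) : (pullGerm hφ y g).value = g.value := by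
  induction g using Germ.inductionOn with | _ g => rfl

/-- Both projections composed with the diagonal are the identity, so on the diagonal
$\Omega(u\otimes v)$ restricts to the product of the germs at $y$. -/
theorem pullGerm_diag_omegaSec (u v : ∀ y : E.Total, Germ (𝓝 y) 𝕜) (y : E.Total) :
    pullGerm E.diag.smooth.continuous y (omegaSec u v (E.diag.toFun y)) = u y * v y := by
  change pullGerm E.diag.smooth.continuous y
    (pullGerm (y := E.diag.toFun y) (φ := (Sh.fst E E).toFun) (Sh.fst E E).smooth.continuous (u y) *
      pullGerm (y := E.diag.toFun y) (φ := (Sh.snd E E).toFun) (Sh.snd E E).smooth.continuous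
        (v y)) = _
  generalize u y = g
  generalize v y = g'
  induction g using Germ.inductionOn with | _ g =>
  induction g' using Germ.inductionOn with | _ g' =>
  rfl

/-! ### Grouplike germs of a sheaf coalgebra -/

section Grouplike

variable {x : M} {u : E.Fn 𝕜} (hu : stalkHom n 𝕜 x u ∈ grouplike (E.coalg 𝕜) x)
include hu

/-- Since $\Delta=\Omega^{-1}\circ\mathrm{diag}_+$, applying the linear map $\Omega$ to
$\Delta_x(u)=u\otimes u$ removes the tensor product and leaves an equation between sections on
$E\times_M E$ over $x$. The next lemmas evaluate it on and off the diagonal. -/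
theorem push_diag_sec_of_grouplike {p : (E.prod E).Total} (hp : (E.prod E).proj p = x) :
    (E.diag.push 𝕜 u).sec p = omegaSec u.sec u.sec p := by
  have h1 : stalkHom n 𝕜 x (E.comul 𝕜 u) = stalkHom n 𝕜 x (BTensor.tmul _ u u) :=
    (stalkHom_comul (E.coalg 𝕜) x u).trans (congrArg _ hu.1)
  obtain ⟨f, hf, hfu⟩ := stalkHom_eq.1 h1
  have h2 := congrArg (omega 𝕜 E E) hfu
  rw [NULin.map_smul, NULin.map_smul, E.omega_comul, omega_tmul] at h2
  exact sec_eq_of_stalkHom_eq (stalkHom_eq.2 ⟨f, hf, h2⟩) hp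

/-- The diagonal point $(y,y)$: there $\mathrm{diag}_+(u)$ restricts to $u_y$ and $\Omega(u\otimes
u)$ to $u_y^2$. -/
theorem isIdempotentElem_sec_of_grouplike {y : E.Total} (hy : E.proj y = x) :
    IsIdempotentElem (u.sec y) := by
  have h := push_diag_sec_of_grouplike hu (p := E.diag.toFun y) ((E.diag.proj_toFun y).trans hy)
  have hinj : Function.Injective E.diag.toFun := fun a b hab =>
    congrArg (Sh.fst E E).toFun hab
  rw [IsIdempotentElem, ← pullGerm_diag_omegaSec, ← h, pullGerm_push_sec _ hinj]

theorem sec_eq_zero_or_one_of_grouplike {y : E.Total} (hy : E.proj y = x) :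
    u.sec y = 0 ∨ u.sec y = 1 := by
  obtain ⟨g, hg, hug⟩ := u.exists_continuous_sec y
  have h := isIdempotentElem_sec_of_grouplike hu hy
  rw [hug] at h ⊢
  exact eq_zero_or_one_of_isIdempotentElem hg h

/-- The point $(y,z)$ is off the diagonal, so $\mathrm{diag}_+(u)$ vanishes there. If both germs
were one, then $\Omega(u\otimes u)$ would have value one at the same point. -/
theorem sec_eq_zero_of_grouplike {y z : E.Total} (hy : E.proj y = x) (hz : E.proj z = x)
    (hyz : y ≠ z) (h1 : u.sec y = 1) : u.sec z = 0 := by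
  refine (sec_eq_zero_or_one_of_grouplike hu hz).resolve_right fun h2 => ?_
  obtain ⟨p, hp1, hp2⟩ := exists_prod (hy.trans hz.symm)
  have h := push_diag_sec_of_grouplike hu (p := p) ((proj_eq_fst p).trans (hp1 ▸ hy))
  rw [push_sec_of_notMem_range] at h
  · have h3 := congrArg Germ.value h
    rw [omegaSec, value_mul_germ, value_pullGerm, value_pullGerm, hp1, hp2, h1, h2] at h3
    exact zero_ne_one (h3.trans (mul_one (1 : 𝕜)))
  · rintro ⟨w, rfl⟩
    exact hyz (hp1.symm.trans hp2)

/-- Otherwise every germ of `u` over `x` is zero, so its class in the local coalgebra is zero, in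
conflict with $\epsilon_x(u)=1$. -/
theorem exists_sec_eq_one_of_grouplike : ∃ y, E.proj y = x ∧ u.sec y = 1 := by
  by_contra! hc
  have h0 : ∀ y, E.proj y = x → u.sec y = 0 := fun y hy =>
    (sec_eq_zero_or_one_of_grouplike hu hy).resolve_right (hc y hy)
  have h1 : stalkHom n 𝕜 x u = 0 := by
    rw [← map_zero (stalkHom n 𝕜 x)]
    exact stalkHom_eq_of_sec fun y hy => by rw [h0 y hy, map_zero]; rfl
  have h2 : localCounit (E.coalg 𝕜) x (stalkHom n 𝕜 x u) = 1 := hu.2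
  have h3 := (map_zero (localCounit (E.coalg 𝕜) x)).symm.trans
    ((congrArg (localCounit (E.coalg 𝕜) x) h1).symm.trans h2)
  exact zero_ne_one (α := 𝕜) (congrArg Germ.value h3)

end Grouplike

/-! ### The unit of the adjunction -/

/-- The germs underlying `p` and `q` lie in different types until the base points are identified.
Exhibiting both as germs of one global element `c` avoids transporting one of them. -/
theorem SpecTotal.ext {p q : SpecTotal C} (h : p.1 = q.1) (c : C.carrier)
    (hp : p.2.1 = stalkHom n 𝕜 p.1 c) (hq : q.2.1 = stalkHom n 𝕜 q.1 c) : p = q := by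
  obtain ⟨x, ζ, hζ⟩ := p
  obtain ⟨x', ζ', hζ'⟩ := q
  obtain rfl : x = x' := h
  obtain rfl : ζ = ζ' := hp.trans hq.symm
  rfl

/-- A local identity `η` for `f` with support in the image of the same `U` provides the second
factor, by $\Delta(f)=f\otimes\eta$. -/
theorem isWeaklyGrouplike_elF {U : Set E.Total} {f : Cc n M 𝕜} (h : IsEl E U f) :
    IsWeaklyGrouplike (C := E.coalg 𝕜) (elF h) := by
  obtain ⟨η, hη, hf⟩ := h.exists_unit
  exact ⟨elF hη, E.comul_elF h hη hf⟩

theorem stalkHom_elF_mem_grouplike {U : Set E.Total} {f : Cc n M 𝕜} (h : IsEl E U f) {x : M}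
    (hf : ∀ᶠ z in 𝓝 x, f.1 z = 1) : stalkHom n 𝕜 x (elF h) ∈ grouplike (E.coalg 𝕜) x := by
  refine (isWeaklyGrouplike_elF h).stalk_mem ?_
  change ((E.counit 𝕜 (elF h)).1 : Germ (𝓝 x) 𝕜) = 1
  rw [E.counit_elF]
  exact Quotient.sound hf

theorem unitAt_mem_grouplike (x : M) (y : {y : E.Total // E.proj y = x}) :
    stalkHom n 𝕜 x (unitAt x y) ∈ grouplike (E.coalg 𝕜) x :=
  stalkHom_elF_mem_grouplike _ (exists_elementary_bump 𝕜 x y).choose_spec.choose_spec.2.2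

variable (𝕜) in
/-- The map `E → E_sp(C_c^∞(E))` that sends `y` to the germ at `π(y)` of a function equal to one
near `y`. -/
def toSpecFun (E : Sh n M) (y : E.Total) : SpecTotal (E.coalg 𝕜) :=
  ⟨E.proj y, stalkHom n 𝕜 (E.proj y) (unitAt (E.proj y) ⟨y, rfl⟩), unitAt_mem_grouplike _ _⟩

/-- Frees the unit from the choice made in `unitAt`: any elementary function equal to one near the
base point, on any elementary set containing `y`, represents the same germ. -/
theorem toSpecFun_eq {U : Set E.Total} {f : Cc n M 𝕜} (h : IsEl E U f) {y : E.Total} (hy : y ∈ U)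
    (hf : ∀ᶠ z in 𝓝 (E.proj y), f.1 z = 1) :
    (toSpecFun 𝕜 E y).2.1 = stalkHom n 𝕜 (E.proj y) (elF h) := by
  have hs := (exists_elementary_bump 𝕜 (E.proj y) ⟨y, rfl⟩).choose_spec.choose_spec
  refine stalk_elF_congr _ h hs.2.1 hy rfl ?_
  filter_upwards [hs.2.2, hf] with z h1 h2
  rw [h1, h2]

/-- One elementary function represents the image of `y` and of all nearby points. If its germ agrees
with that of `c` at one point, it does so nearby, so the preimage of $c_V$ is open. -/
theorem toSpecFun_continuous : Continuous (toSpecFun 𝕜 E) := by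
  refine continuous_generateFrom_iff.2 ?_
  rintro _ ⟨c, V, hV, hc, hcV, rfl⟩
  refine isOpen_iff_mem_nhds.2 fun y ⟨hyV, hyc⟩ => ?_
  obtain ⟨U, η, h, hy, hη⟩ := exists_elementary_bump 𝕜 (E.proj y) ⟨y, rfl⟩
  rw [toSpecFun_eq h hy hη] at hyc
  -- Each of the three conditions at the base point persists at nearby points: membership in `V`,
  -- equality of germs with `c`, and `η` being one in a neighbourhood.
  have hW := (hV.eventually_mem hyV).and ((eventually_stalk_eq hyc).and hη.eventually_nhds)
  filter_upwards [h.isOpen.mem_nhds hy,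
    E.isLocalHomeomorph.continuous.continuousAt.eventually hW] with z hz ⟨hzV, hzc, hzη⟩
  exact ⟨hzV, (toSpecFun_eq h hz hzη).trans hzc⟩

variable (𝕜) in
/-- The unit `E → E_sp(C_c^∞(E))` of the adjunction. -/
def toSpec (E : Sh n M) : Sh.Hom E (spec (E.coalg 𝕜)) :=
  Sh.homOfContinuous (F := spec (E.coalg 𝕜)) (toSpecFun 𝕜 E) toSpecFun_continuous (fun _ => rfl)

/-- An elementary function on `U` equal to one near the base point is pushed forward to the same
function on $\phi(U)$, which represents the image of $\phi(y)$. -/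
theorem toSpecFun_naturality (φ : Sh.Hom E F) (y : E.Total) :
    toSpecFun 𝕜 F (φ.toFun y) = specMapFun (φ.coalgHom 𝕜) (toSpecFun 𝕜 E y) := by
  obtain ⟨U, η, h, hy, hη⟩ := exists_elementary_bump 𝕜 (E.proj y) ⟨y, rfl⟩
  refine SpecTotal.ext (C := F.coalg 𝕜) (φ.proj_toFun y) (elF (h.image φ)) ?_ ?_
  · exact toSpecFun_eq _ (Set.mem_image_of_mem _ hy) (by rwa [φ.proj_toFun])
  · change stalkMap (E.proj y) (φ.push 𝕜) (toSpecFun 𝕜 E y).2.1 = _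
    rw [toSpecFun_eq h hy hη, stalkMap_stalkHom, φ.push_elF]
    rfl

/-! ### Bijectivity of the unit -/

theorem toSpecFun_injective : Function.Injective (toSpecFun 𝕜 E) := by
  intro y z hyz
  obtain ⟨U, f, h, hy, hf⟩ := exists_elementary_bump 𝕜 (E.proj y) ⟨y, rfl⟩
  obtain ⟨V, g, h', hz, hg⟩ := exists_elementary_bump 𝕜 (E.proj z) ⟨z, rfl⟩
  have hp : E.proj y = E.proj z := congrArg Sigma.fst hyz
  -- Stated for a variable `p`, so that the description of the germ at `z` can be used over the base
  -- point of `y`.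
  have h1 : ∀ p, p = toSpecFun 𝕜 E z → p.2.1 = stalkHom n 𝕜 p.1 (elF h') := by
    rintro _ rfl
    exact toSpecFun_eq h' hz hg
  have h2 := sec_eq_of_stalkHom_eq ((toSpecFun_eq h hy hf).symm.trans (h1 _ hyz)) rfl
  rw [elF_sec, elF_sec, el_mem f hy] at h2
  -- If `y` is in `V`, injectivity of the projection on `V` identifies it with `z`. Otherwise the
  -- second function has germ zero at `y`, where the first has value one.
  by_cases hyV : y ∈ V
  · exact h'.injOn hyV hz hp
  · rw [el_not_mem g hyV] at h2
    have h3 : f.1 (E.proj y) = 0 := congrArg Germ.value h2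
    exact absurd (hf.self_of_nhds.symm.trans h3) one_ne_zero

/-- A grouplike germ has section germ one at a single `y` of the fibre and zero at the others, which
are the germs of an elementary function equal to one near `y`. Section germs over $x$ determine the
class. -/
theorem toSpecFun_surjective : Function.Surjective (toSpecFun 𝕜 E) := by
  rintro ⟨x, ζ, hζ⟩
  obtain ⟨u, rfl⟩ := stalkHom_surjective x ζ
  obtain ⟨y, rfl, hy⟩ := exists_sec_eq_one_of_grouplike hζ
  refine ⟨y, SpecTotal.ext (C := E.coalg 𝕜) rfl u ?_ rfl⟩
  obtain ⟨U, f, h, hyU, hf⟩ := exists_elementary_bump 𝕜 (E.proj y) ⟨y, rfl⟩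
  refine (toSpecFun_eq h hyU hf).trans (stalkHom_eq_of_sec fun z hz => ?_)
  rw [elF_sec]
  by_cases hzy : y = z
  · subst hzy
    rw [hy, el_mem f hyU]
    exact Quotient.sound (E.isLocalHomeomorph.continuous.continuousAt.eventually hf)
  · rw [sec_eq_zero_of_grouplike hζ rfl hz hzy hy, el_not_mem f]
    exact fun hzU => hzy (h.injOn hyU hzU hz.symm)

/-- A bijective morphism of sheaves is an isomorphism. -/
theorem Sh.Hom.isIso_of_bijective (φ : E ⟶ F) (h : Function.Bijective (Sh.Hom.toFun φ)) :
    IsIso φ := by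
  let e := Equiv.ofBijective _ h
  -- Morphisms of sheaves are local homeomorphisms, hence open. Smoothness of the inverse is then
  -- automatic, since it is continuous over `M`.
  have hc : Continuous e.symm := by
    refine continuous_def.2 fun U hU => ?_
    rw [← e.image_eq_preimage_symm]
    exact (Sh.Hom.isLocalHomeomorph φ).isOpenMap U hU
  let ψ : F ⟶ E := Sh.homOfContinuous (E := F) (F := E) e.symm hc (fun z => by
    rw [← Sh.Hom.proj_toFun φ]
    exact congrArg F.proj (e.apply_symm_apply z))
  exact ⟨ψ, Sh.Hom.ext (funext e.symm_apply_apply), Sh.Hom.ext (funext e.apply_symm_apply)⟩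

/-! ### The triangle identities and full faithfulness -/

variable (n M 𝕜)

/-- The natural transformation from the identity to `E_sp ∘ C_c^∞`. -/
def toSpecNatTrans : 𝟭 (Sh n M) ⟶ ccFunctor n M 𝕜 ⋙ specFunctor n M 𝕜 where
  app E := toSpec 𝕜 E
  naturality _ _ φ := Sh.Hom.ext (funext (toSpecFun_naturality φ))

/-- The natural transformation from `C_c^∞ ∘ E_sp` to the identity. -/
def evalNatTrans : specFunctor n M 𝕜 ⋙ ccFunctor n M 𝕜 ⟶ 𝟭 (CoAlg.{u} (Cc n M 𝕜)) where
  app C := evalCoalg C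
  naturality _ _ α := CoAlg.Hom.ext (NULin.ext (evalLin_naturality α))

variable {n M 𝕜}

/-- First triangle identity. The point of the spectral sheaf attached to `y` is the germ of
`unitAt`, and multiplying this germ by `f` gives back the germ of the elementary function with
coefficient `f`. -/
theorem evalLin_push_toSpec (u : E.Fn 𝕜) :
    evalLin (E.coalg 𝕜) ((toSpec 𝕜 E).push 𝕜 u) = u := by
  induction u using Sh.Fn.induction with
  | h0 => simp only [map_zero]; rfl
  | hadd u v hu hv => simp only [map_add, hu, hv]; rfl
  | hel U f h =>
    rw [Sh.Hom.push_elF]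
    refine evalHom_elF_eq (C := E.coalg 𝕜) _ ?_ (fun x hx => ?_)
    · rintro _ ⟨y, hy, rfl⟩
      exact (stalk_elF_unitAt h (E.proj y) ⟨y, rfl⟩ hy).symm
    · exact stalk_elF_zero h fun y hy hyx => hx _ ⟨y, hy, rfl⟩ hyx

/-- Second triangle identity. A function equal to one near `p` is evaluated to an element whose germ
is $1\cdot\zeta_p=\zeta_p$. -/
theorem specMapFun_evalCoalg_toSpecFun (p : SpecTotal C) :
    specMapFun (evalCoalg C) (toSpecFun 𝕜 (spec C) p) = p := by
  obtain ⟨U, f, h, hp, hf⟩ := exists_elementary_bump 𝕜 (E := spec C) p.1 ⟨p, rfl⟩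
  refine Sigma.ext rfl (heq_of_eq (Subtype.ext ?_))
  change stalkMap p.1 (evalLin C) (toSpecFun 𝕜 (spec C) p).2.1 = p.2.1
  refine (congrArg (stalkMap p.1 (evalLin C)) (toSpecFun_eq h hp hf)).trans ?_
  exact (stalkHom_evalHom_mem h hp).trans (stalk_smul_one hf _)

variable (n M 𝕜) in
/-- The functor `C_c^∞` is left adjoint to `E_sp`. -/
def ccAdjunction : ccFunctor n M 𝕜 ⊣ specFunctor n M 𝕜 :=
  Adjunction.mkOfUnitCounit
    { unit := toSpecNatTrans n M 𝕜
      counit := evalNatTrans n M 𝕜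
      left_triangle := by
        ext E : 2
        exact CoAlg.Hom.ext (NULin.ext fun u => evalLin_push_toSpec u)
      right_triangle := by
        ext C : 2
        exact Sh.Hom.ext (funext fun p => specMapFun_evalCoalg_toSpecFun p) }

instance : IsIso (ccAdjunction n M 𝕜).unit := by
  have (E : Sh n M) : IsIso ((ccAdjunction n M 𝕜).unit.app E) :=
    Sh.Hom.isIso_of_bijective (toSpec 𝕜 E) ⟨toSpecFun_injective, toSpecFun_surjective⟩
  exact NatIso.isIso_of_isIso_app _

end Adjunction

end SheafCoalg

/-- A left adjoint is fully faithful as soon as the unit of the adjunction is an isomorphism. -/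
theorem theorem10 (n : ℕ) (M : Type u) [TopologicalSpace M]
    [ChartedSpace (EuclideanSpace ℝ (Fin n)) M] [IsManifold (𝓡 n) ∞ M] [T2Space M]
    (𝕜 : Type) [RCLike 𝕜] :
    Nonempty (SheafCoalg.ccFunctor n M 𝕜 ⊣ SheafCoalg.specFunctor n M 𝕜) ∧
      (SheafCoalg.ccFunctor n M 𝕜).Full ∧ (SheafCoalg.ccFunctor n M 𝕜).Faithful :=
  ⟨⟨SheafCoalg.ccAdjunction n M 𝕜⟩,
    (SheafCoalg.ccAdjunction n M 𝕜).fullyFaithfulLOfIsIsoUnit.full,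
    (SheafCoalg.ccAdjunction n M 𝕜).fullyFaithfulLOfIsIsoUnit.faithful⟩
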